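/- A *radial system* $R$ on a finite set $V$ assigns to every $i\in V$ a cyclic ordering $R(i)$ of $V\setminus\{i\}$; a subset $S\subseteq V$ *induces* the radial system on $S$ obtained by restricting each $R(i)$, $i\in S$, to $S\setminus\{i\}$. A *generalized configuration of points* consists of distinct labeled points in the plane together with an arrangement of pseudo-lines (bi-infinite $x$-monotone curves, any two of which meet in exactly one point and cross there), such that each pair of points lies on a pseudo-line and each pseudo-line contains exactly two of the points. $R$ is *realizable as an abstract order type* if there is a generalized configuration of points $(p_i)_{i\in V}$ such that, for every $i$, $R(i)$ is the counterclockwise order of the other points around $p_i$; equivalently, in terms of the orientations $\chi$ of its triples, $j,l,m$ occur in this cyclic order in $R(i)$ iff at least two of the triples $(i,j,l)$, $(i,l,m)$, $(i,m,j)$ are oriented counterclockwise. $R$ is *realizable as a point set order type* if the same holds for a labeled set of points in the plane, no three collinear, with straight lines. **Theorem.** For every $k\ge 3$ there is a radial system $R_k$ on the $2k+1$ elements $v_1,\dots,v_k,w_1,\dots,w_k,u$ with the following properties (indices modulo $k$). 1. $R_k$ is built from a double circle and an additional vertex $u$: for all sufficiently small $\varepsilon>0$, the radial system induced on $\{v_1,\dots,v_k,w_1,\dots,w_k\}$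 is the radial system of the point set in general position that consists of the vertices $v_1,\dots,v_k$ of a regular $k$-gon centered at the origin, in counterclockwise order, and the points $w_i=(1-\varepsilon)\frac{v_i+v_{i+1}}2$; the element $u$ comes directly between $v_{i-1}$ and $v_{i+1}$ in $R_k(v_i)$ (that is, $v_{i-1},u,v_{i+1}$ are consecutive), and directly between $v_i$ and $v_{i+1}$ in $R_k(w_i)$ (that is, $v_i,u,v_{i+1}$ are consecutive). 2. $R_k$ is not realizable as an abstract order type. 3. For every proper subset of the elements (in particular, after the removal of any single element), the induced radial system is realizable as a point set order type. Consequently, realizability cannot be tested on subsets of bounded size: there is no $m\in\mathbb N$ such that every radial system on a finite set, all of whose induced radial systems on at most $m$ elements are realizable as abstract order types, is itself realizable as an abstract order type. -/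

import Mathlib

open Filter Topology

/-! ### Radial systems -/

/-- Pullback of a circular order along an injective map. -/
abbrev circularOrderComap {α β : Type*} (o : CircularOrder α) (f : β → α)
    (hf : Function.Injective f) : CircularOrder β where
  btw a b c := btw (f a) (f b) (f c)
  sbtw a b c := sbtw (f a) (f b) (f c)
  btw_refl a := btw_refl (f a)
  btw_cyclic_left h := btw_cyclic_left h
  sbtw_iff_btw_not_btw := sbtw_iff_btw_not_btw
  sbtw_trans_left h h' := sbtw_trans_left h h'
  btw_antisymm h h' := by
    rcases btw_antisymm h h' with h | h | h
    · exact Or.inl (hf h)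
    · exact Or.inr (Or.inl (hf h))
    · exact Or.inr (Or.inr (hf h))
  btw_total a b c := btw_total (f a) (f b) (f c)

/-- A (candidate) radial system on the label set `V`: for every label `i`, a cyclic ordering of the
labels different from `i`, to be thought of as their counterclockwise order around `i`. -/
structure RadialSystem (V : Type*) where
  order : ∀ i : V, CircularOrder {j : V // j ≠ i}

namespace RadialSystem

variable {V W : Type*}

/-- In the cyclic ordering around `i`, the three distinct labels `j`, `l`, `m` (all different
from `i`) occur in the cyclic order `j`, `l`, `m`. -/
def Ccw (R : RadialSystem V) (i j l m : V) : Prop :=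
  ∃ (hj : j ≠ i) (hl : l ≠ i) (hm : m ≠ i),
    (R.order i).toSBtw.sbtw ⟨j, hj⟩ ⟨l, hl⟩ ⟨m, hm⟩

/-- Going around `i` in the positive direction from `a` to `b`, the label `x` is met, and
no other label is. -/
def DirectlyBetween (R : RadialSystem V) (i a x b : V) : Prop :=
  R.Ccw i a x b ∧ ∀ y, R.Ccw i a y b → y = x

/-- The radial system induced on `W` by an injective relabelling `f : W ↪ V`. -/
def comap (R : RadialSystem V) (f : W ↪ V) : RadialSystem W where
  order i := circularOrderComap (R.order (f i))
    (fun j : {j : W // j ≠ i} => ⟨f j.1, fun h => j.2 (f.injective h)⟩)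
    (fun _ _ h => Subtype.ext (f.injective (congrArg Subtype.val h)))

/-- The radial system induced by a subset of the labels. -/
def induce (R : RadialSystem V) (S : Set V) : RadialSystem S :=
  R.comap (Function.Embedding.subtype (· ∈ S))

end RadialSystem

/-! ### Chirotopes of point sets and of generalized configurations -/

/-- The chirotope of a labeled planar point set: `1` for counterclockwise triples,
`-1` for clockwise triples, `0` for collinear triples. -/
noncomputable def pointChirotope {V : Type*} (p : V → ℝ × ℝ) (a b c : V) : SignType :=
  SignType.sign (((p b).1 - (p a).1) * ((p c).2 - (p a).2)
    - ((p b).2 - (p a).2) * ((p c).1 - (p a).1))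

/-- Labeled points that are pairwise distinct, no three of them on a line. -/
def GeneralPosition {V : Type*} (p : V → ℝ × ℝ) : Prop :=
  Function.Injective p ∧
    ∀ a b c : V, a ≠ b → b ≠ c → a ≠ c → pointChirotope p a b c ≠ 0

/-- The graphs of `f` and `g` have exactly one common point, and they cross there. -/
def CrossOnce (f g : ℝ → ℝ) : Prop :=
  ∃ x₀, f x₀ = g x₀ ∧
    (((∀ x < x₀, f x < g x) ∧ ∀ x > x₀, g x < f x) ∨
      ((∀ x < x₀, g x < f x) ∧ ∀ x > x₀, f x < g x))

/-- A generalized configuration of points: labeled points in the plane together with an arrangement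
of pseudo-lines (bi-infinite `x`-monotone curves, i.e. graphs of continuous functions), one for each
pair of distinct labels, such that every pseudo-line contains exactly the two points of its pair,
and any two pseudo-lines have exactly one common point, at which they cross. The value of `line`
on the degenerate pairs `s(a, a)` is irrelevant. -/
structure GeneralizedConfiguration (V : Type*) where
  pt : V → ℝ × ℝ
  pt_injective : Function.Injective pt
  line : Sym2 V → ℝ → ℝ
  continuous_line : ∀ e, ¬ e.IsDiag → Continuous (line e)
  mem_line_iff : ∀ e, ¬ e.IsDiag → ∀ c, (pt c).2 = line e (pt c).1 ↔ c ∈ e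
  crossOnce : ∀ e f, ¬ e.IsDiag → ¬ f.IsDiag → e ≠ f → CrossOnce (line e) (line f)

/-- The chirotope of a generalized configuration. For distinct `a`, `b`, `c` it is `1` if `c` is to
the left of the pseudo-line through `a` and `b`, directed from `a` to `b` (above it if `a` is
horizontally before `b`, below it if `a` is horizontally after `b`), and `-1` otherwise. It is `0`
if two of the labels coincide. -/
noncomputable def GeneralizedConfiguration.chirotope {V : Type*} (Q : GeneralizedConfiguration V)
    (a b c : V) : SignType :=
  SignType.sign (((Q.pt b).1 - (Q.pt a).1) * ((Q.pt c).2 - Q.line s(a, b) (Q.pt c).1))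

/-! ### The radial system of a chirotope and realizability -/

/-- Around `i`, the labels `j`, `l`, `m` occur in this counterclockwise order. Of the three
angular gaps, from `j` to `l`, from `l` to `m` and from `m` to `j`, at most one exceeds a half-turn
if the order is counterclockwise, and at least two do if it is clockwise; a gap is less than a
half-turn precisely if the corresponding triple is oriented counterclockwise. -/
def CcwAround {V : Type*} (χ : V → V → V → SignType) (i j l m : V) : Prop :=
  (χ i j l = 1 ∧ χ i l m = 1) ∨ (χ i l m = 1 ∧ χ i m j = 1) ∨ (χ i m j = 1 ∧ χ i j l = 1)

namespace RadialSystem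

variable {V : Type*}

/-- `R` is the counterclockwise radial system of the chirotope `χ`. -/
def IsRadialSystemOf (R : RadialSystem V) (χ : V → V → V → SignType) : Prop :=
  ∀ i j l m : V, j ≠ i → l ≠ i → m ≠ i → j ≠ l → l ≠ m → j ≠ m →
    (R.Ccw i j l m ↔ CcwAround χ i j l m)

/-- `R` is the radial system of the labeled point set `p`, which is in general position. -/
def IsRealizedByPoints (R : RadialSystem V) (p : V → ℝ × ℝ) : Prop :=
  GeneralPosition p ∧ R.IsRadialSystemOf (pointChirotope p)

/-- `R` is realizable as a point set order type. -/
def RealizableAsPointSet (R : RadialSystem V) : Prop :=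
  ∃ p : V → ℝ × ℝ, R.IsRealizedByPoints p

/-- `R` is realizable as an abstract order type. -/
def RealizableAsAbstractOrderType (R : RadialSystem V) : Prop :=
  ∃ Q : GeneralizedConfiguration V, R.IsRadialSystemOf Q.chirotope

end RadialSystem

/-! ### The double circle with an additional vertex -/

/-- The vertex with index `i` (modulo `k`) of a regular `k`-gon, in counterclockwise order. -/
noncomputable def polygonVertex (k i : ℕ) : ℝ × ℝ :=
  (Real.cos (2 * Real.pi * i / k), Real.sin (2 * Real.pi * i / k))

/-- The points of the double circle: the vertices `v i` of a regular `k`-gon (left summand), and for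
each `i` the point `w i` (right summand) obtained by moving the midpoint of the edge from `v i` to
`v (i + 1)` towards the center by the factor `1 - ε`. -/
noncomputable def doubleCircle (k : ℕ) (ε : ℝ) : Fin k ⊕ Fin k → ℝ × ℝ
  | Sum.inl i => polygonVertex k i
  | Sum.inr i => (1 - ε) • midpoint ℝ (polygonVertex k i) (polygonVertex k (i + 1))

/-- The labels `v i`, `w i` of the double circle and one additional label `u`. -/
abbrev DCVertex (k : ℕ) : Type := Option (Fin k ⊕ Fin k)

namespace DCVertex

variable {k : ℕ}

abbrev v (i : Fin k) : DCVertex k := some (Sum.inl i)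

abbrev w (i : Fin k) : DCVertex k := some (Sum.inr i)

abbrev u : DCVertex k := none

end DCVertex

open DCVertex in
/-- `R` is built from a double circle and one additional vertex `u`: without `u` it is the radial
system of the double circle whose inner points are arbitrarily close to the midpoints of the edges;
`u` comes directly between `v (i - 1)` and `v (i + 1)` around `v i`, and directly between `v i` and
`v (i + 1)` around `w i`, indices modulo `k`. -/
def IsDoubleCirclePlusVertex {k : ℕ} (R : RadialSystem (DCVertex k)) : Prop :=
  (∀ᶠ ε in 𝓝[>] (0 : ℝ),
    (R.comap Function.Embedding.some).IsRealizedByPoints (doubleCircle k ε)) ∧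
  (∀ i : Fin k, R.DirectlyBetween (v i) (v ((finRotate k).symm i)) u (v (finRotate k i))) ∧
  (∀ i : Fin k, R.DirectlyBetween (w i) (v i) u (v (finRotate k i)))

/-! The radial system places `u` at infinity outside every edge of the double circle at once: around
each point of the double circle `u` comes last in a list of ranks, and around `u` the boundary is
traversed clockwise. Locally this is consistent, globally it is not.

Non-realizability uses little of the theory of pseudo-lines: the chirotope is alternating, and it
satisfies the axiom `interiority`. A quadruple whose radial system looks convex has its four
orientations forced by a sign computation (`eq_one_of_convex`). Applied to quadruples of the double
circle it gives many positive triples; applied to `v i`, `u`, `v (i + 1)`, `w i` it shows that `u`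
is beyond the edge from `v i` to `v (i + 1)` and `w i` on its other side. By interiority, the
triangles of the fan from `v 0` are counterclockwise. Gluing them one after another, again by
interiority, `u` stays beyond each diagonal from `v 0` to `v j`. For `j = k - 1` this diagonal is an
edge, and being beyond it in this direction contradicts `u` being beyond it in the boundary
direction.

If a point of the double circle is missing, the cycle can be cut there and unrolled into a convex
chain with dents over a parabola, with `u` far below: no constraint closes the cycle any more. If
`u` is missing, the double circle itself is a realization. Signs there are found at `ε = 0` by
continuity, except for the triples `v i`, `w i`, `v (i + 1)`, which degenerate and are computed
exactly.

For unbounded testing, point sets have to be turned into generalized configurations. A small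
perturbation removes vertical and parallel connecting lines, after which the straight lines serve as
pseudo-lines. -/

/-! ### Orientations in generalized configurations: alternation and interiority -/

/-- The sign function `χ` of triples is alternating and nonzero on triples of distinct labels. -/
structure IsAlternatingChirotope {V : Type*} (χ : V → V → V → SignType) : Prop where
  swap_left : ∀ a b c, χ b a c = -χ a b c
  swap_right : ∀ a b c, a ≠ b → b ≠ c → a ≠ c → χ a c b = -χ a b c
  ne_zero : ∀ a b c, a ≠ b → b ≠ c → a ≠ c → χ a b c ≠ 0

/-- The difference `f - g` changes sign at the unique common point and nowhere else, and `h₀`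
identifies that point with `x₀`. -/
theorem CrossOnce.sign_mul_eq {f g : ℝ → ℝ} (h : CrossOnce f g) {x₀ x y : ℝ} (h₀ : f x₀ = g x₀)
    (hx : x ≠ x₀) (hy : y ≠ x₀) :
    SignType.sign (f x - g x) * SignType.sign (x - x₀) =
      SignType.sign (f y - g y) * SignType.sign (y - x₀) := by
  obtain ⟨z, -, hz⟩ := h
  have hzx : z = x₀ := by
    rcases lt_trichotomy x₀ z with h | h | h
    · rcases hz with hz | hz
      · exact absurd h₀ (hz.1 _ h).ne
      · exact absurd h₀ (hz.1 _ h).ne'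
    · exact h.symm
    · rcases hz with hz | hz
      · exact absurd h₀ (hz.2 _ h).ne'
      · exact absurd h₀ (hz.2 _ h).ne
  subst hzx
  rcases hz with hz | hz
  · have key : ∀ t, t ≠ z → SignType.sign (f t - g t) * SignType.sign (t - z) = 1 := by
      intro t ht
      rcases lt_or_gt_of_ne ht with h | h
      · rw [sign_neg (sub_neg.2 (hz.1 t h)), sign_neg (sub_neg.2 h)]; rfl
      · rw [sign_pos (sub_pos.2 (hz.2 t h)), sign_pos (sub_pos.2 h)]; rfl
    rw [key x hx, key y hy]
  · have key : ∀ t, t ≠ z → SignType.sign (f t - g t) * SignType.sign (t - z) = -1 := by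
      intro t ht
      rcases lt_or_gt_of_ne ht with h | h
      · rw [sign_pos (sub_pos.2 (hz.1 t h)), sign_neg (sub_neg.2 h)]; rfl
      · rw [sign_neg (sub_neg.2 (hz.2 t h)), sign_pos (sub_pos.2 h)]; rfl
    rw [key x hx, key y hy]

namespace GeneralizedConfiguration

variable {V : Type*} (Q : GeneralizedConfiguration V)

theorem line_left {a b : V} (h : a ≠ b) : Q.line s(a, b) (Q.pt a).1 = (Q.pt a).2 :=
  ((Q.mem_line_iff s(a, b) (by simpa using h) a).2 (by simp)).symm

theorem line_right {a b : V} (h : a ≠ b) : Q.line s(a, b) (Q.pt b).1 = (Q.pt b).2 :=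
  ((Q.mem_line_iff s(a, b) (by simpa using h) b).2 (by simp)).symm

/-- The pseudo-line through both points is the graph of a function, so equal abscissas would force
equal points. -/
theorem fst_ne {a b : V} (h : a ≠ b) : (Q.pt a).1 ≠ (Q.pt b).1 := fun hx =>
  h (Q.pt_injective (Prod.ext hx (by rw [← Q.line_left h, ← Q.line_right h, hx])))

theorem chirotope_eq {a b c : V} (hac : a ≠ c) :
    Q.chirotope a b c = SignType.sign ((Q.pt b).1 - (Q.pt a).1) *
      SignType.sign (Q.line s(a, c) (Q.pt c).1 - Q.line s(a, b) (Q.pt c).1) := by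
  rw [chirotope, sign_mul, Q.line_right hac]

theorem sign_line_sub {a b c : V} (hab : a ≠ b) (hbc : b ≠ c) (hac : a ≠ c) {x y : ℝ}
    (hx : x ≠ (Q.pt a).1) (hy : y ≠ (Q.pt a).1) :
    SignType.sign (Q.line s(a, c) x - Q.line s(a, b) x) * SignType.sign (x - (Q.pt a).1) =
      SignType.sign (Q.line s(a, c) y - Q.line s(a, b) y) * SignType.sign (y - (Q.pt a).1) := by
  refine (Q.crossOnce s(a, c) s(a, b) (by simpa using hac) (by simpa using hab) ?_).sign_mul_eq
    (by rw [Q.line_left hac, Q.line_left hab]) hx hy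
  intro h
  rw [Sym2.eq_iff] at h
  rcases h with h | h
  · exact hbc h.2.symm
  · exact hab h.1

/-- Only `swap_right` needs the crossing axiom: it compares the pseudo-lines `ab` and `ac` at the
abscissas of `c` and of `b`, and these two pseudo-lines exchange their vertical order exactly at
`a`. -/
theorem isAlternatingChirotope : IsAlternatingChirotope Q.chirotope where
  swap_left a b c := by
    rw [chirotope, chirotope, Sym2.eq_swap, ← Left.sign_neg]
    congr 1
    ring
  swap_right a b c hab hbc hac := by
    rw [Q.chirotope_eq hac, Q.chirotope_eq hab, ← neg_sub (Q.line s(a, c) _), Left.sign_neg]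
    have h := Q.sign_line_sub hab hbc hac (Q.fst_ne hac.symm) (Q.fst_ne hab.symm)
    have h₁ : SignType.sign ((Q.pt b).1 - (Q.pt a).1) ≠ 0 :=
      sign_ne_zero.2 (sub_ne_zero.2 (Q.fst_ne hab.symm))
    have h₂ : SignType.sign ((Q.pt c).1 - (Q.pt a).1) ≠ 0 :=
      sign_ne_zero.2 (sub_ne_zero.2 (Q.fst_ne hac.symm))
    revert h h₁ h₂
    generalize SignType.sign ((Q.pt b).1 - (Q.pt a).1) = s₁
    generalize SignType.sign ((Q.pt c).1 - (Q.pt a).1) = s₂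
    generalize SignType.sign (Q.line s(a, c) (Q.pt c).1 - _) = s₃
    generalize SignType.sign (Q.line s(a, c) (Q.pt b).1 - _) = s₄
    revert s₁ s₂ s₃ s₄
    decide
  ne_zero a b c hab hbc hac := by
    rw [chirotope, sign_ne_zero]
    refine mul_ne_zero (sub_ne_zero.2 (Q.fst_ne hab.symm)) (sub_ne_zero.2 fun h => ?_)
    rw [Q.mem_line_iff _ (by simpa using hab)] at h
    rcases Sym2.mem_iff.1 h with h | h
    · exact hac h.symm
    · exact hbc h.symm

theorem chirotope_eq_of_leftmost {a b c : V} (hbc : b ≠ c) (hb : (Q.pt a).1 < (Q.pt b).1)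
    (hc : (Q.pt a).1 < (Q.pt c).1) {x : ℝ} (hx : (Q.pt a).1 < x) :
    Q.chirotope a b c = SignType.sign (Q.line s(a, c) x - Q.line s(a, b) x) := by
  have hab : a ≠ b := by rintro rfl; exact lt_irrefl _ hb
  have hac : a ≠ c := by rintro rfl; exact lt_irrefl _ hc
  have h := Q.sign_line_sub hab hbc hac hc.ne' hx.ne'
  rw [sign_pos (sub_pos.2 hc), sign_pos (sub_pos.2 hx), mul_one, mul_one] at h
  rw [Q.chirotope_eq hac, h, sign_pos (sub_pos.2 hb), one_mul]

/-- To the right of `a` the pseudo-lines through `a` do not meet, so they are linearly ordered by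
height. For points to the right of `a`, a positive orientation says that the second pseudo-line is
higher, which cannot go round a cycle of three. -/
theorem not_cyclic_around_leftmost {a b c d : V} (hbc : b ≠ c) (hcd : c ≠ d) (hbd : b ≠ d)
    (hb : (Q.pt a).1 < (Q.pt b).1) (hc : (Q.pt a).1 < (Q.pt c).1) (hd : (Q.pt a).1 < (Q.pt d).1) :
    ¬ (Q.chirotope a b c = 1 ∧ Q.chirotope a c d = 1 ∧ Q.chirotope a d b = 1) := by
  rw [Q.chirotope_eq_of_leftmost hbc hb hc hb, Q.chirotope_eq_of_leftmost hcd hc hd hb,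
    Q.chirotope_eq_of_leftmost hbd.symm hd hb hb, sign_eq_one_iff, sign_eq_one_iff,
    sign_eq_one_iff]
  rintro ⟨h₁, h₂, h₃⟩
  linarith

/-- A point that lies to the left of the three directed sides of a triangle forces the triangle
to be counterclockwise. -/
theorem interiority {t a b c : V} (hta : t ≠ a) (htb : t ≠ b) (htc : t ≠ c) (hab : a ≠ b)
    (hbc : b ≠ c) (hac : a ≠ c) (h₁ : Q.chirotope t a b = 1) (h₂ : Q.chirotope t b c = 1)
    (h₃ : Q.chirotope t c a = 1) : Q.chirotope a b c = 1 := by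
  have alt := Q.isAlternatingChirotope
  -- If `a`, `b`, `c` were clockwise, each of the four points would see the other three in a
  -- positive cycle. This is impossible for the leftmost of the four, which the case distinction at
  -- the end locates.
  by_contra hn
  have hneg : ∀ s : SignType, s ≠ 0 → s ≠ 1 → -s = 1 := by decide
  have h₄ : Q.chirotope a c b = 1 := by
    rw [alt.swap_right a b c hab hbc hac]
    exact hneg _ (alt.ne_zero a b c hab hbc hac) hn
  have rot : ∀ x y z : V, x ≠ y → y ≠ z → x ≠ z → Q.chirotope x y z = 1 →
      Q.chirotope y z x = 1 := by
    intro x y z hxy hyz hxz h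
    rw [alt.swap_right y x z hxy.symm hxz hyz, alt.swap_left x y z, h]; rfl
  have hx : ∀ {x y : V}, x ≠ y → (Q.pt x).1 ≤ (Q.pt y).1 → (Q.pt x).1 < (Q.pt y).1 :=
    fun h h' => lt_of_le_of_ne h' (Q.fst_ne h)
  have left : ∀ x y z s : V, x ≠ y → x ≠ z → x ≠ s → y ≠ z → z ≠ s → y ≠ s →
      (Q.pt x).1 ≤ (Q.pt y).1 → (Q.pt x).1 ≤ (Q.pt z).1 → (Q.pt x).1 ≤ (Q.pt s).1 →
      Q.chirotope x y z = 1 → Q.chirotope x z s = 1 → Q.chirotope x s y = 1 → False :=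
    fun x y z s n₁ n₂ n₃ n₄ n₅ n₆ l₁ l₂ l₃ c₁ c₂ c₃ =>
      Q.not_cyclic_around_leftmost n₄ n₅ n₆ (hx n₁ l₁) (hx n₂ l₂) (hx n₃ l₃) ⟨c₁, c₂, c₃⟩
  have e₁ := rot _ _ _ hta hab htb h₁
  have e₂ := rot _ _ _ htb hbc htc h₂
  have e₃ := rot _ _ _ htc hac.symm hta h₃
  have f₁ := rot _ _ _ hab htb.symm hta.symm e₁
  have f₂ := rot _ _ _ hbc htc.symm htb.symm e₂
  have f₃ := rot _ _ _ hac.symm hta.symm htc.symm e₃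
  have h₅ := rot _ _ _ hac hbc.symm hab h₄
  have h₆ := rot _ _ _ hbc.symm hab.symm hac.symm h₅
  rcases le_total (Q.pt t).1 (Q.pt a).1 with l₁ | l₁ <;>
  rcases le_total (Q.pt b).1 (Q.pt c).1 with l₂ | l₂
  · rcases le_total (Q.pt t).1 (Q.pt b).1 with l₃ | l₃
    · exact left t a b c hta htb htc hab hbc hac l₁ l₃ (l₃.trans l₂) h₁ h₂ h₃
    · exact left b a c t hab.symm hbc htb.symm hac htc.symm hta.symm (l₃.trans l₁) l₂ l₃ h₆ e₂ f₁
  · rcases le_total (Q.pt t).1 (Q.pt c).1 with l₃ | l₃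
    · exact left t a b c hta htb htc hab hbc hac l₁ (l₃.trans l₂) l₃ h₁ h₂ h₃
    · exact left c b a t hbc.symm hac.symm htc.symm hab.symm hta.symm htb.symm l₂ (l₃.trans l₁) l₃
        h₅ e₃ f₂
  · rcases le_total (Q.pt a).1 (Q.pt b).1 with l₃ | l₃
    · exact left a c b t hac hab hta.symm hbc.symm htb.symm htc.symm (l₃.trans l₂) l₃ l₁ h₄ e₁ f₃
    · exact left b a c t hab.symm hbc htb.symm hac htc.symm hta.symm l₃ l₂ (l₃.trans l₁) h₆ e₂ f₁
  · rcases le_total (Q.pt a).1 (Q.pt c).1 with l₃ | l₃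
    · exact left a c b t hac hab hta.symm hbc.symm htb.symm htc.symm l₃ (l₃.trans l₂) l₁ h₄ e₁ f₃
    · exact left c b a t hbc.symm hac.symm htc.symm hab.symm hta.symm htb.symm l₂ l₃ (l₃.trans l₁)
        h₅ e₃ f₂

end GeneralizedConfiguration

/-! ### The combinatorial model: radial systems defined by integer ranks -/

/-- The three numbers are distinct and cyclically ordered. -/
def CyclicLT (a b c : ℤ) : Prop := (a < b ∧ b < c) ∨ (b < c ∧ c < a) ∨ (c < a ∧ a < b)

/-- The radial system whose cyclic orderings are given by integer keys. -/
def RadialSystem.ofKey {V : Type*} (key : V → V → ℤ)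
    (hkey : ∀ i j l, j ≠ i → l ≠ i → key i j = key i l → j = l) : RadialSystem V where
  order i := circularOrderComap (LinearOrder.toCircularOrder ℤ)
    (fun j : {j : V // j ≠ i} => key i j.1)
    (fun j l h => Subtype.ext (hkey i j.1 l.1 j.2 l.2 h))

theorem RadialSystem.ofKey_ccw {V : Type*} {key : V → V → ℤ}
    {hkey : ∀ i j l, j ≠ i → l ≠ i → key i j = key i l → j = l} {i j l m : V} :
    (RadialSystem.ofKey key hkey).Ccw i j l m ↔
      j ≠ i ∧ l ≠ i ∧ m ≠ i ∧ CyclicLT (key i j) (key i l) (key i m) := by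
  constructor
  · rintro ⟨hj, hl, hm, h⟩
    exact ⟨hj, hl, hm, h⟩
  · rintro ⟨hj, hl, hm, h⟩
    exact ⟨hj, hl, hm, h⟩

/-- The distance from `a` to `b` in positive direction on a cycle of length `N`, for distinct
`a` and `b` that differ by less than `N`. -/
def cyclicGap (N a b : ℤ) : ℤ := if a < b then b - a else b - a + N

/-- The rank of `b` in the counterclockwise order around `a` in the double circle with `N` points,
numbered along its boundary such that the even numbers belong to the extreme points. -/
def radialRank (N a b : ℤ) : ℤ :=
  if a % 2 = 0 then
    -- Inner points are pushed inwards, so an extreme point sees the next extreme point before the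
    -- inner point between them, and symmetrically on the other side. Around an inner point the
    -- order is that of the boundary.
    if cyclicGap N a b = 1 then 2
    else if cyclicGap N a b = 2 then 1
    else if cyclicGap N a b = N - 1 then N - 2
    else if cyclicGap N a b = N - 2 then N - 1
    else cyclicGap N a b
  else cyclicGap N a b

namespace DCVertex

variable {k : ℕ}

/-- The position along the boundary of the double circle. -/
def position : Fin k ⊕ Fin k → ℤ
  | Sum.inl i => 2 * (i : ℕ)
  | Sum.inr i => 2 * (i : ℕ) + 1

theorem position_nonneg (x : Fin k ⊕ Fin k) : 0 ≤ position x := by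
  rcases x with i | i <;> simp only [position] <;> omega

theorem position_lt (x : Fin k ⊕ Fin k) : position x < 2 * k := by
  rcases x with i | i <;> simp only [position] <;> omega

theorem position_injective : Function.Injective (position (k := k)) := by
  rintro (i | i) (j | j) h <;> simp only [position] at h
  · exact congrArg _ (Fin.ext (by omega))
  · omega
  · omega
  · exact congrArg _ (Fin.ext (by omega))

theorem exists_position_eq {t : ℤ} (h₀ : 0 ≤ t) (h : t < 2 * k) :
    ∃ x : Fin k ⊕ Fin k, position x = t := by
  rcases Int.emod_two_eq_zero_or_one t with ht | ht
  · exact ⟨Sum.inl ⟨(t / 2).toNat, by omega⟩, by simp only [position]; omega⟩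
  · exact ⟨Sum.inr ⟨(t / 2).toNat, by omega⟩, by simp only [position]; omega⟩

/-- The rank of a label in the counterclockwise order around another one. The label `u` comes last
around the points of the double circle, and sees them in clockwise order. -/
def rank : DCVertex k → DCVertex k → ℤ
  | some x, some y => radialRank (2 * k) (position x) (position y)
  | some _, none => 2 * k
  | none, some y => -position y
  | none, none => 0

end DCVertex

theorem radialRank_mem {N a b : ℤ} (hN : 6 ≤ N) (h : a ≠ b) (h₁ : a < b + N) (h₂ : b < a + N) :
    1 ≤ radialRank N a b ∧ radialRank N a b < N := by
  unfold radialRank cyclicGap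
  split_ifs <;> omega

theorem radialRank_injective {N a b c : ℤ} (hN : 6 ≤ N) (hb : a ≠ b) (hc : a ≠ c)
    (hb₁ : a < b + N) (hb₂ : b < a + N) (hc₁ : a < c + N) (hc₂ : c < a + N)
    (hbc₁ : b < c + N) (hbc₂ : c < b + N) (h : radialRank N a b = radialRank N a c) : b = c := by
  have hg : cyclicGap N a b = cyclicGap N a c := by
    unfold radialRank at h
    have hg₁ : 1 ≤ cyclicGap N a b ∧ cyclicGap N a b < N := by
      unfold cyclicGap; split_ifs <;> omega
    have hg₂ : 1 ≤ cyclicGap N a c ∧ cyclicGap N a c < N := by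
      unfold cyclicGap; split_ifs <;> omega
    generalize cyclicGap N a b = g at *
    generalize cyclicGap N a c = g' at *
    split_ifs at h <;> omega
  unfold cyclicGap at hg
  split_ifs at hg <;> omega

namespace DCVertex

variable {k : ℕ}

theorem rank_injective (hk : 3 ≤ k) (i j l : DCVertex k) (hj : j ≠ i) (hl : l ≠ i)
    (h : rank i j = rank i l) : j = l := by
  have hne : ∀ {x y : Fin k ⊕ Fin k}, (some y : DCVertex k) ≠ some x → position x ≠ position y :=
    fun h h' => h (congrArg some (position_injective h').symm)
  have hb : ∀ x y : Fin k ⊕ Fin k, position x < position y + 2 * k := fun x y => by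
    have := position_lt x; have := position_nonneg y; omega
  rcases i with _ | x <;> rcases j with _ | y <;> rcases l with _ | z <;> simp only [rank] at h
  · rfl
  · exact absurd rfl hj
  · exact absurd rfl hl
  · exact congrArg some (position_injective (by omega))
  · rfl
  · have := radialRank_mem (by omega) (hne hl) (hb _ _) (hb _ _)
    omega
  · have := radialRank_mem (by omega) (hne hj) (hb _ _) (hb _ _)
    omega
  · exact congrArg some (position_injective (radialRank_injective (by omega) (hne hj) (hne hl)
      (hb _ _) (hb _ _) (hb _ _) (hb _ _) (hb _ _) (hb _ _) h))

end DCVertex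

/-- The radial system of the double circle with the additional label `u`, which appears at infinity
from all points. -/
def doubleCircleSystem {k : ℕ} (hk : 3 ≤ k) : RadialSystem (DCVertex k) :=
  RadialSystem.ofKey DCVertex.rank (DCVertex.rank_injective hk)

open DCVertex

theorem doubleCircleSystem_ccw {k : ℕ} (hk : 3 ≤ k) {i j l m : DCVertex k} :
    (doubleCircleSystem hk).Ccw i j l m ↔
      j ≠ i ∧ l ≠ i ∧ m ≠ i ∧ CyclicLT (rank i j) (rank i l) (rank i m) :=
  RadialSystem.ofKey_ccw

theorem val_finRotate_cases {k : ℕ} (i : Fin k) :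
    ((i : ℕ) + 1 = k ∧ ((finRotate k i : Fin k) : ℕ) = 0) ∨
      ((i : ℕ) + 1 < k ∧ ((finRotate k i : Fin k) : ℕ) = i + 1) := by
  obtain _ | k := k
  · exact i.elim0
  · by_cases h : (i : ℕ) + 1 = k + 1
    · have : i = Fin.last k := Fin.ext (by simp only [Fin.val_last]; omega)
      subst this
      exact Or.inl ⟨h, by rw [finRotate_last]; rfl⟩
    · exact Or.inr ⟨by omega, coe_finRotate_of_ne_last (fun h' => h (by rw [h']; simp))⟩

theorem rank_mem {k : ℕ} (hk : 3 ≤ k) {x y : Fin k ⊕ Fin k} (h : x ≠ y) :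
    1 ≤ radialRank (2 * k) (position x) (position y) ∧
      radialRank (2 * k) (position x) (position y) < 2 * k := by
  have := position_lt x; have := position_nonneg x
  have := position_lt y; have := position_nonneg y
  exact radialRank_mem (by omega) (fun h' => h (position_injective h')) (by omega) (by omega)

/-- Around a point of the double circle the ranks of the others fill the range from `1` to `2 * k -
1` and `u` has rank `2 * k`, so `u` alone lies cyclically between the last and the first of them. -/
theorem directlyBetween_of_rank {k : ℕ} (hk : 3 ≤ k) {x a b : Fin k ⊕ Fin k} (hxa : x ≠ a)
    (hxb : x ≠ b)
    (ha : radialRank (2 * k) (position x) (position a) = 2 * k - 1)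
    (hb : radialRank (2 * k) (position x) (position b) = 1) :
    (doubleCircleSystem hk).DirectlyBetween (some x) (some a) u (some b) := by
  refine ⟨(doubleCircleSystem_ccw hk).2 ⟨by simpa using hxa.symm, by simp, by simpa using hxb.symm,
    ?_⟩, fun y hy => ?_⟩
  · simp only [rank, CyclicLT]
    omega
  · obtain ⟨-, hyx, -, h⟩ := (doubleCircleSystem_ccw hk).1 hy
    rcases y with _ | y
    · rfl
    · have := rank_mem hk (x := x) (y := y) (by rintro rfl; exact hyx rfl)
      simp only [rank, CyclicLT] at h
      omega

theorem directlyBetween_v {k : ℕ} (hk : 3 ≤ k) (i : Fin k) :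
    (doubleCircleSystem hk).DirectlyBetween (v i) (v ((finRotate k).symm i)) u
      (v (finRotate k i)) := by
  have h₁ := val_finRotate_cases i
  have h₂ := val_finRotate_cases ((finRotate k).symm i)
  rw [Equiv.apply_symm_apply] at h₂
  generalize (finRotate k).symm i = a at *
  generalize finRotate k i = b at *
  have := i.2; have := a.2; have := b.2
  apply directlyBetween_of_rank hk
  · rintro h
    cases h
    omega
  · rintro h
    cases h
    omega
  · simp only [position, radialRank, cyclicGap]
    split_ifs <;> omega
  · simp only [position, radialRank, cyclicGap]
    split_ifs <;> omega

theorem directlyBetween_w {k : ℕ} (hk : 3 ≤ k) (i : Fin k) :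
    (doubleCircleSystem hk).DirectlyBetween (w i) (v i) u (v (finRotate k i)) := by
  have h₁ := val_finRotate_cases i
  generalize finRotate k i = b at *
  have := i.2; have := b.2
  apply directlyBetween_of_rank hk
  · simp
  · simp
  · simp only [position, radialRank, cyclicGap]
    split_ifs <;> omega
  · simp only [position, radialRank, cyclicGap]
    split_ifs <;> omega

/-! ### Ranks versus orientations in the double circle -/

theorem cyclicGap_cases (N a b : ℤ) :
    (a < b ∧ cyclicGap N a b = b - a) ∨ (b ≤ a ∧ cyclicGap N a b = b - a + N) := by
  unfold cyclicGap
  split_ifs <;> omega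

/-- The number triple `(a, b, c)` is counterclockwise in the double circle with `N` points. -/
def DoubleCircleCcw (N a b c : ℤ) : Prop :=
  -- The exceptions are the three rotations of the dent triple `v i`, `w i`, `v (i + 1)`, which is
  -- clockwise although it follows the boundary order; the last three alternatives are its
  -- reversals.
  (cyclicGap N a b < cyclicGap N a c ∧
    ¬ (a % 2 = 0 ∧ cyclicGap N a b = 1 ∧ cyclicGap N a c = 2) ∧
    ¬ (a % 2 = 0 ∧ cyclicGap N a b = N - 2 ∧ cyclicGap N a c = N - 1) ∧
    ¬ (a % 2 = 1 ∧ cyclicGap N a b = 1 ∧ cyclicGap N a c = N - 1)) ∨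
  (a % 2 = 0 ∧ cyclicGap N a b = 2 ∧ cyclicGap N a c = 1) ∨
  (a % 2 = 0 ∧ cyclicGap N a b = N - 1 ∧ cyclicGap N a c = N - 2) ∨
  (a % 2 = 1 ∧ cyclicGap N a b = N - 1 ∧ cyclicGap N a c = 1)

theorem radialRank_odd {N a b : ℤ} (ha : a % 2 = 1) : radialRank N a b = cyclicGap N a b := by
  unfold radialRank
  rw [if_neg (by omega)]

/-- An extreme point sees all others within less than a half-turn, so there the linear order of
ranks is the orientation. This fails at an inner point, whose two neighbours are more than a
half-turn apart on the inner side. -/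
theorem radialRank_lt_iff {N a b c : ℤ} (hN : 6 ≤ N) (ha : a % 2 = 0) (hb : a ≠ b) (hc : a ≠ c)
    (hb₁ : a < b + N) (hb₂ : b < a + N) (hc₁ : a < c + N) (hc₂ : c < a + N) :
    radialRank N a b < radialRank N a c ↔ DoubleCircleCcw N a b c := by
  have h₁ := cyclicGap_cases N a b
  have h₂ := cyclicGap_cases N a c
  have hg₁ : 1 ≤ cyclicGap N a b ∧ cyclicGap N a b < N := by omega
  have hg₂ : 1 ≤ cyclicGap N a c ∧ cyclicGap N a c < N := by omega
  unfold radialRank DoubleCircleCcw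
  clear h₁ h₂
  generalize cyclicGap N a b = g at *
  generalize cyclicGap N a c = g' at *
  rw [if_pos ha, if_pos ha]
  split_ifs <;> omega

/-- Points in the cyclic order of a double circle are seen in this order from each of them, if the
double circle does not contain a point near the edge between two others. -/
theorem cyclicLT_radialRank {N a b c d : ℤ} (hN : 6 ≤ N)
    (hb : a ≠ b) (hc : a ≠ c) (hd : a ≠ d)
    (hb₁ : a < b + N) (hb₂ : b < a + N) (hc₁ : a < c + N) (hc₂ : c < a + N)
    (hd₁ : a < d + N) (hd₂ : d < a + N)
    (hbc : cyclicGap N a b < cyclicGap N a c) (hcd : cyclicGap N a c < cyclicGap N a d)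
    (h₁ : ¬ (cyclicGap N a b = 1 ∧ cyclicGap N a c = 2))
    (h₂ : ¬ (cyclicGap N a c = N - 2 ∧ cyclicGap N a d = N - 1)) :
    CyclicLT (radialRank N a b) (radialRank N a c) (radialRank N a d) := by
  refine Or.inl ?_
  rcases Int.emod_two_eq_zero_or_one a with ha | ha
  · rw [radialRank_lt_iff hN ha hb hc hb₁ hb₂ hc₁ hc₂, radialRank_lt_iff hN ha hc hd hc₁ hc₂ hd₁ hd₂]
    have h₃ := cyclicGap_cases N a b
    have h₄ := cyclicGap_cases N a d
    unfold DoubleCircleCcw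
    omega
  · rw [radialRank_odd ha, radialRank_odd ha, radialRank_odd ha]
    exact ⟨hbc, hcd⟩

/-! ### Orientations that are forced by the radial system -/

namespace IsAlternatingChirotope

variable {V : Type*} {χ : V → V → V → SignType}

theorem rotate (alt : IsAlternatingChirotope χ) {a b c : V} (hab : a ≠ b) (hbc : b ≠ c) (hac : a ≠ c) : χ b c a = χ a b c := by
  rw [alt.swap_right b a c hab.symm hac hbc, alt.swap_left a b c, neg_neg]

/-- The chirotope of four points in convex position is determined by their radial system. -/
theorem eq_one_of_convex (alt : IsAlternatingChirotope χ) {a b c d : V} (hab : a ≠ b) (hac : a ≠ c) (had : a ≠ d)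
    (hbc : b ≠ c) (hbd : b ≠ d) (hcd : c ≠ d) (ha : CcwAround χ a b c d) (hb : CcwAround χ b c d a)
    (hc : CcwAround χ c d a b) (hd : CcwAround χ d a b c) :
    χ a b c = 1 ∧ χ a b d = 1 ∧ χ a c d = 1 ∧ χ b c d = 1 := by
  unfold CcwAround at *
  rw [alt.swap_right a b d hab hbd had] at ha
  rw [alt.rotate hab hbd had, alt.swap_left a b c] at hb
  rw [alt.rotate hac hcd had, ← alt.rotate hac.symm hab hbc.symm, alt.swap_left b c d] at hc
  rw [← alt.rotate had.symm hab hbd.symm, ← alt.rotate hbd.symm hbc hcd.symm,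
    alt.swap_left c d a, alt.rotate hac hcd had] at hd
  have n₁ := alt.ne_zero a b c hab hbc hac
  have n₂ := alt.ne_zero a b d hab hbd had
  have n₃ := alt.ne_zero a c d hac hcd had
  have n₄ := alt.ne_zero b c d hbc hcd hbd
  generalize χ a b c = s₁ at *
  generalize χ a b d = s₂ at *
  generalize χ a c d = s₃ at *
  generalize χ b c d = s₄ at *
  clear * - ha hb hc hd n₁ n₂ n₃ n₄
  -- Each hypothesis now says that at least two of three signs, one of them negated, are positive.
  -- The only assignment satisfying all four majorities is the one with all signs positive, a
  -- propositional fact.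
  have hneg : ∀ s : SignType, s ≠ 0 → (-s = 1 ↔ ¬ s = 1) := by decide
  rw [hneg _ n₂] at ha
  rw [hneg _ n₁] at hb
  rw [hneg _ n₄] at hc
  rw [hneg _ n₃] at hd
  tauto

theorem eq_one_swap (alt : IsAlternatingChirotope χ) {a b c : V} (hab : a ≠ b) (hbc : b ≠ c) (hac : a ≠ c) (h : χ a b c ≠ 1) :
    χ a c b = 1 := by
  have hneg : ∀ s : SignType, s ≠ 0 → s ≠ 1 → -s = 1 := by decide
  rw [alt.swap_right a b c hab hbc hac]
  exact hneg _ (alt.ne_zero a b c hab hbc hac) h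

theorem not_both (alt : IsAlternatingChirotope χ) {a b c : V} (hab : a ≠ b) (hbc : b ≠ c) (hac : a ≠ c) (h : χ a b c = 1)
    (h' : χ a c b = 1) : False := by
  rw [alt.swap_right a b c hab hbc hac, h] at h'
  exact absurd h' (by decide)

end IsAlternatingChirotope

section Realization

variable {k : ℕ} {hk : 3 ≤ k} {χ : DCVertex k → DCVertex k → DCVertex k → SignType}

theorem some_ne_of_position_ne {x y : Fin k ⊕ Fin k} (h : position x ≠ position y) :
    (some x : DCVertex k) ≠ some y :=
  fun h' => h (congrArg position (Option.some_injective _ h'))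

theorem ccwAround_of_rank (hR : (doubleCircleSystem hk).IsRadialSystemOf χ) {i j l m : DCVertex k}
    (hj : j ≠ i) (hl : l ≠ i) (hm : m ≠ i) (hjl : j ≠ l) (hlm : l ≠ m) (hjm : j ≠ m)
    (h : CyclicLT (rank i j) (rank i l) (rank i m)) : CcwAround χ i j l m :=
  (hR _ _ _ _ hj hl hm hjl hlm hjm).1 ((doubleCircleSystem_ccw hk).2 ⟨hj, hl, hm, h⟩)

theorem ccwAround_of_cyclicGap (hR : (doubleCircleSystem hk).IsRadialSystemOf χ)
    {a b c d : Fin k ⊕ Fin k}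
    (hab : (some a : DCVertex k) ≠ some b) (hac : (some a : DCVertex k) ≠ some c)
    (had : (some a : DCVertex k) ≠ some d) (hbc : (some b : DCVertex k) ≠ some c)
    (hcd : (some c : DCVertex k) ≠ some d) (hbd : (some b : DCVertex k) ≠ some d)
    (h : cyclicGap (2 * k) (position a) (position b) < cyclicGap (2 * k) (position a) (position c) ∧
      cyclicGap (2 * k) (position a) (position c) < cyclicGap (2 * k) (position a) (position d) ∧
      ¬ (cyclicGap (2 * k) (position a) (position b) = 1 ∧
        cyclicGap (2 * k) (position a) (position c) = 2) ∧
      ¬ (cyclicGap (2 * k) (position a) (position c) = 2 * k - 2 ∧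
        cyclicGap (2 * k) (position a) (position d) = 2 * k - 1)) :
    CcwAround χ (some a) (some b) (some c) (some d) := by
  have := position_nonneg a; have := position_lt a
  have := position_nonneg b; have := position_lt b
  have := position_nonneg c; have := position_lt c
  have := position_nonneg d; have := position_lt d
  have hne : ∀ {y : Fin k ⊕ Fin k}, (some a : DCVertex k) ≠ some y → position a ≠ position y :=
    fun h h' => h (congrArg some (position_injective h'))
  exact ccwAround_of_rank hR hab.symm hac.symm had.symm hbc hcd hbd
    (cyclicLT_radialRank (by omega) (hne hab) (hne hac) (hne had) (by omega) (by omega) (by omega)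
      (by omega) (by omega) (by omega) h.1 h.2.1 h.2.2.1 h.2.2.2)

/-- The conditions `e₁` to `e₄` exclude three cyclically consecutive positions. Then no rank swap
affects the quadruple, each point sees the other three in boundary order, and `eq_one_of_convex`
applies. -/
theorem chirotope_of_convex (hR : (doubleCircleSystem hk).IsRadialSystemOf χ)
    (alt : IsAlternatingChirotope χ) {a b c d : Fin k ⊕ Fin k} (hab : position a < position b)
    (hbc : position b < position c) (hcd : position c < position d)
    (e₁ : ¬ (position b = position a + 1 ∧ position c = position a + 2))
    (e₂ : ¬ (position c = position b + 1 ∧ position d = position b + 2))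
    (e₃ : ¬ (position d = position c + 1 ∧ position a + 2 * k = position c + 2))
    (e₄ : ¬ (position a + 2 * k = position d + 1 ∧ position b + 2 * k = position d + 2)) :
    χ (some a) (some b) (some c) = 1 ∧ χ (some a) (some b) (some d) = 1 ∧
      χ (some a) (some c) (some d) = 1 ∧ χ (some b) (some c) (some d) = 1 := by
  have nab := some_ne_of_position_ne hab.ne
  have nac := some_ne_of_position_ne (hab.trans hbc).ne
  have nad := some_ne_of_position_ne (hab.trans (hbc.trans hcd)).ne
  have nbc := some_ne_of_position_ne hbc.ne
  have nbd := some_ne_of_position_ne (hbc.trans hcd).ne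
  have ncd := some_ne_of_position_ne hcd.ne
  have ha := position_nonneg a
  have hd := position_lt d
  refine alt.eq_one_of_convex nab nac nad nbc nbd ncd
    (ccwAround_of_cyclicGap hR nab nac nad nbc ncd nbd ?_)
    (ccwAround_of_cyclicGap hR nbc nbd nab.symm ncd nad.symm nac.symm ?_)
    (ccwAround_of_cyclicGap hR ncd nac.symm nbc.symm nad.symm nab nbd.symm ?_)
    (ccwAround_of_cyclicGap hR nad.symm nbd.symm ncd.symm nab nbc nac ?_)
  · have h₁ := cyclicGap_cases (2 * k) (position a) (position b)
    have h₂ := cyclicGap_cases (2 * k) (position a) (position c)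
    have h₃ := cyclicGap_cases (2 * k) (position a) (position d)
    omega
  · have h₁ := cyclicGap_cases (2 * k) (position b) (position c)
    have h₂ := cyclicGap_cases (2 * k) (position b) (position d)
    have h₃ := cyclicGap_cases (2 * k) (position b) (position a)
    omega
  · have h₁ := cyclicGap_cases (2 * k) (position c) (position d)
    have h₂ := cyclicGap_cases (2 * k) (position c) (position a)
    have h₃ := cyclicGap_cases (2 * k) (position c) (position b)
    omega
  · have h₁ := cyclicGap_cases (2 * k) (position d) (position a)
    have h₂ := cyclicGap_cases (2 * k) (position d) (position b)
    have h₃ := cyclicGap_cases (2 * k) (position d) (position c)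
    omega

/-- The point `u` lies beyond each edge from `v i` to `v (i + 1)`, and `w i` on the other side. -/
theorem chirotope_near_edge (hR : (doubleCircleSystem hk).IsRadialSystemOf χ)
    (alt : IsAlternatingChirotope χ) {a b c : Fin k ⊕ Fin k} (ha₂ : position a % 2 = 0)
    (hb : position b = position a + 1)
    (hc : position c = position a + 2 ∨ (position c = 0 ∧ position a + 2 = 2 * k)) :
    χ (some a) u (some c) = 1 ∧ χ (some a) (some c) (some b) = 1 := by
  have := position_nonneg a; have := position_lt a
  have := position_nonneg b; have := position_lt b
  have := position_nonneg c; have := position_lt c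
  have nab := some_ne_of_position_ne (x := a) (y := b) (by omega)
  have nac := some_ne_of_position_ne (x := a) (y := c) (by omega)
  have nbc := some_ne_of_position_ne (x := b) (y := c) (by omega)
  have hu : ∀ x : Fin k ⊕ Fin k, (some x : DCVertex k) ≠ u := fun x => by simp
  have rab : radialRank (2 * k) (position a) (position b) = 2 := by
    have := cyclicGap_cases (2 * k) (position a) (position b)
    unfold radialRank; split_ifs <;> omega
  have rac : radialRank (2 * k) (position a) (position c) = 1 := by
    have := cyclicGap_cases (2 * k) (position a) (position c)
    unfold radialRank; split_ifs <;> omega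
  have rca : radialRank (2 * k) (position c) (position a) = 2 * k - 1 := by
    have := cyclicGap_cases (2 * k) (position c) (position a)
    unfold radialRank; split_ifs <;> omega
  have rcb : radialRank (2 * k) (position c) (position b) = 2 * k - 2 := by
    have := cyclicGap_cases (2 * k) (position c) (position b)
    unfold radialRank; split_ifs <;> omega
  have rba : radialRank (2 * k) (position b) (position a) = 2 * k - 1 := by
    have := cyclicGap_cases (2 * k) (position b) (position a)
    unfold radialRank; split_ifs <;> omega
  have rbc : radialRank (2 * k) (position b) (position c) = 1 := by
    have := cyclicGap_cases (2 * k) (position b) (position c)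
    unfold radialRank; split_ifs <;> omega
  -- The radial system presents `a`, `u`, `c`, `b` as a convex quadrilateral in this cyclic order,
  -- with the edge `ac` as a diagonal separating `u` from `b`.
  have := alt.eq_one_of_convex (hu a) nac nab (hu c).symm (hu b).symm nbc.symm
    (ccwAround_of_rank hR (hu a).symm nac.symm nab.symm (hu c).symm nbc.symm (hu b).symm (by
      simp only [rank, rab, rac, CyclicLT]; omega))
    (ccwAround_of_rank hR (hu c) (hu b) (hu a) nbc.symm nab.symm nac.symm (by
      simp only [rank, CyclicLT]; omega))
    (ccwAround_of_rank hR nbc nac (hu c).symm nab.symm (hu a) (hu b) (by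
      simp only [rank, rca, rcb, CyclicLT]; omega))
    (ccwAround_of_rank hR nab (hu b).symm nbc.symm (hu a) (hu c).symm nac (by
      simp only [rank, rba, rbc, CyclicLT]; omega))
  exact ⟨this.1, this.2.2.1⟩

end Realization

/-! ### Non-realizability as an abstract order type -/

theorem doubleCircleSystem_not_realizable {k : ℕ} (hk : 3 ≤ k) :
    ¬ (doubleCircleSystem hk).RealizableAsAbstractOrderType := by
  rintro ⟨Q, hR⟩
  have alt := Q.isAlternatingChirotope
  -- An inverse of `position`, extended by an arbitrary value, so that the argument can use integer
  -- positions.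
  obtain ⟨L, hL⟩ : ∃ L : ℤ → Fin k ⊕ Fin k, ∀ t : ℤ, 0 ≤ t → t < 2 * k → position (L t) = t := by
    have : ∀ t : ℤ, ∃ x : Fin k ⊕ Fin k, 0 ≤ t → t < 2 * k → position x = t := fun t => by
      by_cases h : 0 ≤ t ∧ t < 2 * k
      · obtain ⟨x, hx⟩ := exists_position_eq h.1 h.2
        exact ⟨x, fun _ _ => hx⟩
      · exact ⟨Sum.inl ⟨0, by omega⟩, fun h₁ h₂ => absurd ⟨h₁, h₂⟩ h⟩
    choose L hL using this
    exact ⟨L, hL⟩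
  let X : ℤ → DCVertex k := fun t => some (L t)
  have hne : ∀ {s t : ℤ}, 0 ≤ s → s < 2 * k → 0 ≤ t → t < 2 * k → s ≠ t → X s ≠ X t :=
    fun {s t} hs hs' ht ht' hst => some_ne_of_position_ne (by rwa [hL s hs hs', hL t ht ht'])
  have hu : ∀ t, X t ≠ u := fun t => Option.some_ne_none _
  have convex : ∀ a b c d : ℤ, 0 ≤ a → a < b → b < c → c < d → d < 2 * k →
      ¬ (b = a + 1 ∧ c = a + 2) → ¬ (c = b + 1 ∧ d = b + 2) →
      ¬ (d = c + 1 ∧ a + 2 * k = c + 2) → ¬ (a + 2 * k = d + 1 ∧ b + 2 * k = d + 2) →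
      Q.chirotope (X a) (X b) (X c) = 1 ∧ Q.chirotope (X a) (X b) (X d) = 1 ∧
        Q.chirotope (X a) (X c) (X d) = 1 ∧ Q.chirotope (X b) (X c) (X d) = 1 := by
    intro a b c d ha hab hbc hcd hd e₁ e₂ e₃ e₄
    have pa := hL a (by omega) (by omega)
    have pb := hL b (by omega) (by omega)
    have pc := hL c (by omega) (by omega)
    have pd := hL d (by omega) (by omega)
    apply chirotope_of_convex hR alt <;> simp only [pa, pb, pc, pd] <;> assumption
  have near : ∀ a b c : ℤ, 0 ≤ a → a % 2 = 0 → b = a + 1 → b < 2 * k →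
      ((c = a + 2 ∧ c < 2 * k) ∨ (c = 0 ∧ a + 2 = 2 * k)) →
      Q.chirotope (X a) u (X c) = 1 ∧ Q.chirotope (X a) (X c) (X b) = 1 := by
    intro a b c ha ha₂ hb hb' hc
    have pa := hL a (by omega) (by omega)
    have pb := hL b (by omega) (by omega)
    have pc := hL c (by omega) (by omega)
    apply chirotope_near_edge hR alt <;> simp only [pa, pb, pc] <;> omega
  -- If `X 0`, `X b`, `X (b + 2)` were clockwise, then `X 0` would see `X b`, `X (b + 1)`, `X (b +
  -- 2)` in a positive cycle. By interiority these three would be counterclockwise, but they form a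
  -- dent. The auxiliary fourth points `b + 3` and `b - 1` avoid three consecutive positions.
  have fan : ∀ b : ℤ, 2 ≤ b → b % 2 = 0 → b + 2 < 2 * k →
      Q.chirotope (X 0) (X b) (X (b + 2)) = 1 := by
    intro b hb hb₂ hbk
    have n0b := hne (s := 0) (t := b) (by omega) (by omega) (by omega) (by omega) (by omega)
    have n0c := hne (s := 0) (t := b + 1) (by omega) (by omega) (by omega) (by omega) (by omega)
    have n0d := hne (s := 0) (t := b + 2) (by omega) (by omega) (by omega) (by omega) (by omega)
    have nbc := hne (s := b) (t := b + 1) (by omega) (by omega) (by omega) (by omega) (by omega)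
    have nbd := hne (s := b) (t := b + 2) (by omega) (by omega) (by omega) (by omega) (by omega)
    have ncd := hne (s := b + 1) (t := b + 2) (by omega) (by omega) (by omega) (by omega) (by omega)
    by_contra h
    have h₁ := (convex 0 b (b + 1) (b + 3) (by omega) (by omega) (by omega) (by omega) (by omega)
      (by omega) (by omega) (by omega) (by omega)).1
    have h₂ := (convex 0 (b - 1) (b + 1) (b + 2) (by omega) (by omega) (by omega) (by omega)
      (by omega) (by omega) (by omega) (by omega) (by omega)).2.2.1
    have h₃ := alt.eq_one_swap n0b nbd n0d h
    have h₄ := Q.interiority n0b n0c n0d nbc ncd nbd h₁ h₂ h₃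
    exact alt.not_both nbc ncd nbd h₄
      (near b (b + 1) (b + 2) (by omega) hb₂ rfl (by omega) (by omega)).2
  -- Being beyond the diagonal from `X 0` to `X b` and beyond the edge from `X b` to `X (b + 2)`,
  -- `u` is also beyond the diagonal from `X 0` to `X (b + 2)`. Otherwise it would see the three
  -- points in a positive cycle in the order `X b`, `X 0`, `X (b + 2)`, which is clockwise by `fan`.
  have beyond : ∀ n : ℕ, n + 1 < k → Q.chirotope (X 0) u (X (2 * (n + 1 : ℕ))) = 1 := by
    intro n
    induction n with
    | zero => exact fun hn => (near 0 1 _ le_rfl rfl rfl (by omega) (by omega)).1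
    | succ n ih =>
      intro hn
      have hT := fan (2 * (n + 1 : ℕ)) (by omega) (by omega) (by omega)
      have hb := ih (by omega)
      have hbd := (near (2 * (n + 1 : ℕ)) _ (2 * (n + 1 : ℕ) + 2) (by omega) (by omega) rfl
        (by omega) (by omega)).1
      have hd : (2 * (n + 1 + 1 : ℕ) : ℤ) = 2 * (n + 1 : ℕ) + 2 := by push_cast; ring
      rw [hd]
      generalize hbdef : (2 * (n + 1 : ℕ) : ℤ) = b at *
      have n0b := hne (s := 0) (t := b) (by omega) (by omega) (by omega) (by omega) (by omega)
      have n0d := hne (s := 0) (t := b + 2) (by omega) (by omega) (by omega) (by omega) (by omega)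
      have nbd := hne (s := b) (t := b + 2) (by omega) (by omega) (by omega) (by omega) (by omega)
      by_contra h
      have h₁ := alt.eq_one_swap (hu 0) (hu _).symm n0d h
      rw [← alt.rotate (hu 0) (hu _).symm n0b] at hb
      rw [← alt.rotate (hu b) (hu _).symm nbd] at hbd
      rw [alt.rotate (hu 0).symm n0d (hu _).symm] at h₁
      exact alt.not_both n0b nbd n0d hT (by
        rw [alt.rotate n0b.symm n0d nbd]
        exact Q.interiority (hu _).symm (hu _).symm (hu _).symm n0b.symm n0d nbd hb h₁ hbd)
  -- The last diagonal joins `v 0` and `v (k - 1)`. It is also the closing edge of the polygon, and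
  -- `near` puts `u` on its other side.
  have h₁ := beyond (k - 2) (by omega)
  have h₂ := (near (2 * (k - 2 + 1 : ℕ)) _ 0 (by omega) (by omega) rfl (by omega) (by omega)).1
  have n0 := hne (s := 0) (t := 2 * (k - 2 + 1 : ℕ)) (by omega) (by omega) (by omega) (by omega)
    (by omega)
  rw [← alt.rotate (hu _) (hu 0).symm n0.symm] at h₂
  rw [← alt.rotate (hu 0) (hu _).symm n0] at h₁
  exact alt.not_both (hu 0).symm n0 (hu _).symm h₂ h₁

/-! ### A point of the double circle is missing: convex chains with dents -/

theorem pointChirotope_swap_left {V : Type*} (p : V → ℝ × ℝ) (a b c : V) :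
    pointChirotope p b a c = -pointChirotope p a b c := by
  rw [pointChirotope, pointChirotope, ← Left.sign_neg]
  congr 1
  ring

theorem pointChirotope_rotate {V : Type*} (p : V → ℝ × ℝ) (a b c : V) :
    pointChirotope p b c a = pointChirotope p a b c := by
  rw [pointChirotope, pointChirotope]
  congr 1
  ring

theorem CcwAround.rotate_iff {V : Type*} {χ : V → V → V → SignType} {i j l m : V} :
    CcwAround χ i j l m ↔ CcwAround χ i l m j := by
  unfold CcwAround
  tauto

theorem CyclicLT.rotate_iff {a b c : ℤ} : CyclicLT a b c ↔ CyclicLT b c a := by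
  unfold CyclicLT
  tauto

theorem RadialSystem.comap_ccw {V W : Type*} {R : RadialSystem V} {f : W ↪ V} {i j l m : W} :
    (R.comap f).Ccw i j l m ↔ R.Ccw (f i) (f j) (f l) (f m) := by
  constructor
  · rintro ⟨hj, hl, hm, h⟩
    exact ⟨f.injective.ne hj, f.injective.ne hl, f.injective.ne hm, h⟩
  · rintro ⟨hj, hl, hm, h⟩
    exact ⟨fun e => hj (congrArg f e), fun e => hl (congrArg f e), fun e => hm (congrArg f e), h⟩

theorem cyclicGap_of_lt {N a b : ℤ} (h : a < b) : cyclicGap N a b = b - a := if_pos h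

theorem cyclicGap_of_gt {N a b : ℤ} (h : b < a) : cyclicGap N a b = b - a + N :=
  if_neg h.not_gt

theorem doubleCircleCcw_odd {N a b c : ℤ} (ha : a % 2 = 1) :
    DoubleCircleCcw N a b c ↔
      (cyclicGap N a b < cyclicGap N a c ∧ ¬ (cyclicGap N a b = 1 ∧ cyclicGap N a c = N - 1)) ∨
      (cyclicGap N a b = N - 1 ∧ cyclicGap N a c = 1) := by
  simp [DoubleCircleCcw, ha]

theorem doubleCircleCcw_even {N a b c : ℤ} (ha : a % 2 = 0) :
    DoubleCircleCcw N a b c ↔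
      (cyclicGap N a b < cyclicGap N a c ∧ ¬ (cyclicGap N a b = 1 ∧ cyclicGap N a c = 2) ∧
        ¬ (cyclicGap N a b = N - 2 ∧ cyclicGap N a c = N - 1)) ∨
      (cyclicGap N a b = 2 ∧ cyclicGap N a c = 1) ∨
      (cyclicGap N a b = N - 1 ∧ cyclicGap N a c = N - 2) := by
  simp [DoubleCircleCcw, ha]

/-- The majority rule of `CcwAround` for the double circle. At odd `a`, the orientations deviate
from the order of gaps only for the pair of neighbours with gaps `1` and `N - 1`. At most one of the
three pairs is affected, and the majority absorbs it. -/
theorem cyclicLT_radialRank_iff {N a b c d : ℤ} (hN : 6 ≤ N)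
    (hb : a ≠ b) (hc : a ≠ c) (hd : a ≠ d) (hbc : b ≠ c) (hcd : c ≠ d) (hbd : b ≠ d)
    (hb₁ : a < b + N) (hb₂ : b < a + N) (hc₁ : a < c + N) (hc₂ : c < a + N)
    (hd₁ : a < d + N) (hd₂ : d < a + N)
    (hbc₁ : b < c + N) (hbc₂ : c < b + N) (hcd₁ : c < d + N) (hcd₂ : d < c + N)
    (hbd₁ : b < d + N) (hbd₂ : d < b + N) :
    CyclicLT (radialRank N a b) (radialRank N a c) (radialRank N a d) ↔
      (DoubleCircleCcw N a b c ∧ DoubleCircleCcw N a c d) ∨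
      (DoubleCircleCcw N a c d ∧ DoubleCircleCcw N a d b) ∨
      (DoubleCircleCcw N a d b ∧ DoubleCircleCcw N a b c) := by
  unfold CyclicLT
  rcases Int.emod_two_eq_zero_or_one a with ha | ha
  · rw [radialRank_lt_iff hN ha hb hc hb₁ hb₂ hc₁ hc₂, radialRank_lt_iff hN ha hc hd hc₁ hc₂ hd₁ hd₂,
      radialRank_lt_iff hN ha hd hb hd₁ hd₂ hb₁ hb₂]
  · rw [radialRank_odd ha, radialRank_odd ha, radialRank_odd ha]
    have h₁ := cyclicGap_cases N a b
    have h₂ := cyclicGap_cases N a c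
    have h₃ := cyclicGap_cases N a d
    have k₁ : 1 ≤ cyclicGap N a b ∧ cyclicGap N a b < N := by omega
    have k₂ : 1 ≤ cyclicGap N a c ∧ cyclicGap N a c < N := by omega
    have k₃ : 1 ≤ cyclicGap N a d ∧ cyclicGap N a d < N := by omega
    have n₁ : cyclicGap N a b ≠ cyclicGap N a c := by omega
    have n₂ : cyclicGap N a c ≠ cyclicGap N a d := by omega
    have n₃ : cyclicGap N a b ≠ cyclicGap N a d := by omega
    rw [doubleCircleCcw_odd ha, doubleCircleCcw_odd ha, doubleCircleCcw_odd ha]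
    clear h₁ h₂ h₃
    generalize cyclicGap N a b = g₁ at *
    generalize cyclicGap N a c = g₂ at *
    generalize cyclicGap N a d = g₃ at *
    clear * - hN k₁ k₂ k₃ n₁ n₂ n₃
    rcases lt_or_gt_of_ne n₁ with h₁ | h₁ <;> rcases lt_or_gt_of_ne n₂ with h₂ | h₂ <;>
      rcases lt_or_gt_of_ne n₃ with h₃ | h₃ <;>
      simp only [h₁, h₂, h₃, h₁.not_gt, h₂.not_gt, h₃.not_gt, true_and, false_and, and_true,
        and_false, or_true, or_false, false_or, true_iff, false_iff] <;> omega

/-- Twice the oriented area determined by the points with the numbers `a`, `b`, `c` on a convex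
chain with dents, up to a factor. -/
def chainDet (a b c : ℤ) : ℤ :=
  (b - a) * (2 * (c ^ 2 - a ^ 2) + 3 * (c % 2 - a % 2)) -
    (2 * (b ^ 2 - a ^ 2) + 3 * (b % 2 - a % 2)) * (c - a)

/-- With steps `x` and `y`, the parabola contributes `2 * (x * y) * (x + y)` and the dents subtract
at most `3 * (x + y)`. Convexity wins once `x * y ≥ 2`; for `x = y = 1` the dents win exactly if the
middle number is odd. -/
theorem chainDet_pos {a b c : ℤ} (hab : a < b) (hbc : b < c)
    (h : ¬ (a % 2 = 0 ∧ b = a + 1 ∧ c = a + 2)) : 0 < chainDet a b c := by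
  obtain ⟨x, rfl⟩ : ∃ x, b = a + x := ⟨b - a, by ring⟩
  obtain ⟨y, rfl⟩ : ∃ y, c = a + x + y := ⟨c - (a + x), by ring⟩
  have hx : 1 ≤ x := by omega
  have hy : 1 ≤ y := by omega
  have hoa : 0 ≤ a % 2 ∧ a % 2 ≤ 1 := by omega
  have hob : 0 ≤ (a + x) % 2 ∧ (a + x) % 2 ≤ 1 := by omega
  have hoc : 0 ≤ (a + x + y) % 2 ∧ (a + x + y) % 2 ≤ 1 := by omega
  have hdet : chainDet a (a + x) (a + x + y) = 2 * (x * y) * (x + y) +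
      3 * ((a % 2) * y - ((a + x) % 2) * (x + y) + ((a + x + y) % 2) * x) := by
    unfold chainDet
    ring
  have h' : (x = 1 ∧ y = 1 ∧ (a + x) % 2 = 0) ∨ 2 ≤ x ∨ 2 ≤ y := by omega
  rw [hdet]
  generalize a % 2 = o₁ at *
  generalize (a + x) % 2 = o₂ at *
  generalize (a + x + y) % 2 = o₃ at *
  have e₁ : 0 ≤ o₁ * y := mul_nonneg hoa.1 (by omega)
  have e₂ : o₂ * (x + y) ≤ 1 * (x + y) := mul_le_mul_of_nonneg_right hob.2 (by omega)
  have e₃ : 0 ≤ o₃ * x := mul_nonneg hoc.1 (by omega)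
  rcases h' with ⟨rfl, rfl, rfl⟩ | h' | h'
  · linarith
  · have : 2 ≤ x * y := by nlinarith
    nlinarith
  · have : 2 ≤ x * y := by nlinarith
    nlinarith

theorem chainDet_neg {a : ℤ} (ha : a % 2 = 0) : chainDet a (a + 1) (a + 2) < 0 := by
  have h₁ : (a + 1) % 2 = 1 := by omega
  have h₂ : (a + 2) % 2 = 0 := by omega
  unfold chainDet
  rw [ha, h₁, h₂]
  ring_nf
  norm_num

theorem chainDet_ne_zero_of_lt {a b c : ℤ} (hab : a < b) (hbc : b < c) : chainDet a b c ≠ 0 := by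
  by_cases h : a % 2 = 0 ∧ b = a + 1 ∧ c = a + 2
  · obtain ⟨h, rfl, rfl⟩ := h
    exact (chainDet_neg h).ne
  · exact (chainDet_pos hab hbc h).ne'

theorem chainDet_pos_iff_of_lt {a b c : ℤ} (hab : a < b) (hbc : b < c) :
    0 < chainDet a b c ↔ ¬ (a % 2 = 0 ∧ b = a + 1 ∧ c = a + 2) := by
  refine ⟨?_, chainDet_pos hab hbc⟩
  rintro h ⟨h', rfl, rfl⟩
  exact h.not_gt (chainDet_neg h')

theorem chainDet_rotate (a b c : ℤ) : chainDet b c a = chainDet a b c := by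
  unfold chainDet; ring

theorem chainDet_swap (a b c : ℤ) : chainDet b a c = -chainDet a b c := by
  unfold chainDet; ring

theorem chainDet_ne_zero {a b c : ℤ} (hab : a ≠ b) (hbc : b ≠ c) (hac : a ≠ c) :
    chainDet a b c ≠ 0 := by
  have key : ∀ {a b c : ℤ}, a < b → b ≠ c → a ≠ c → chainDet a b c ≠ 0 := by
    intro a b c hab hbc hac
    rcases lt_or_gt_of_ne hbc with h | h
    · exact chainDet_ne_zero_of_lt hab h
    · rcases lt_or_gt_of_ne hac with h' | h'
      · rw [← chainDet_rotate, ← chainDet_rotate, chainDet_swap, neg_ne_zero]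
        exact chainDet_ne_zero_of_lt h' h
      · rw [← chainDet_rotate, ← chainDet_rotate]
        exact chainDet_ne_zero_of_lt h' hab
  rcases lt_or_gt_of_ne hab with h | h
  · exact key h hbc hac
  · rw [chainDet_swap, neg_ne_zero]
    exact key h hac hbc

/-- The numbers differ by at most `N - 2`, since one residue is missing from the chain. Hence a dent
triple cannot wrap around and occurs only as three consecutive integers. -/
theorem chainDet_pos_iff {N a b c : ℤ} (hN : 6 ≤ N) (hN₂ : N % 2 = 0) (hab : a ≠ b) (hbc : b ≠ c)
    (hac : a ≠ c) (hab₁ : a + 1 < b + N) (hab₂ : b + 1 < a + N) (hbc₁ : b + 1 < c + N)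
    (hbc₂ : c + 1 < b + N) (hac₁ : a + 1 < c + N) (hac₂ : c + 1 < a + N) :
    0 < chainDet a b c ↔ DoubleCircleCcw N a b c := by
  have hneg : ∀ {x y z : ℤ}, x < y → y < z → (0 < -chainDet x y z ↔
      (x % 2 = 0 ∧ y = x + 1 ∧ z = x + 2)) := by
    intro x y z hxy hyz
    have h₁ := chainDet_pos_iff_of_lt hxy hyz
    have h₂ := chainDet_ne_zero_of_lt hxy hyz
    constructor
    · intro h
      by_contra h'
      have := h₁.2 h'
      omega
    · intro h
      have : ¬ 0 < chainDet x y z := fun h' => h₁.1 h' h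
      omega
  rcases lt_or_gt_of_ne hab with h₁ | h₁ <;> rcases lt_or_gt_of_ne hbc with h₂ | h₂ <;>
    rcases lt_or_gt_of_ne hac with h₃ | h₃
  · rw [chainDet_pos_iff_of_lt h₁ h₂]
    rcases Int.emod_two_eq_zero_or_one a with ha | ha
    · rw [doubleCircleCcw_even ha, cyclicGap_of_lt h₁, cyclicGap_of_lt h₃]
      omega
    · rw [doubleCircleCcw_odd ha, cyclicGap_of_lt h₁, cyclicGap_of_lt h₃]
      omega
  · omega
  · rw [← chainDet_rotate, ← chainDet_rotate, chainDet_swap, hneg h₃ h₂]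
    rcases Int.emod_two_eq_zero_or_one a with ha | ha
    · rw [doubleCircleCcw_even ha, cyclicGap_of_lt h₁, cyclicGap_of_lt h₃]
      omega
    · rw [doubleCircleCcw_odd ha, cyclicGap_of_lt h₁, cyclicGap_of_lt h₃]
      omega
  · rw [← chainDet_rotate, ← chainDet_rotate, chainDet_pos_iff_of_lt h₃ h₁]
    rcases Int.emod_two_eq_zero_or_one a with ha | ha
    · rw [doubleCircleCcw_even ha, cyclicGap_of_lt h₁, cyclicGap_of_gt h₃]
      omega
    · rw [doubleCircleCcw_odd ha, cyclicGap_of_lt h₁, cyclicGap_of_gt h₃]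
      omega
  · rw [chainDet_swap, hneg h₁ h₃]
    rcases Int.emod_two_eq_zero_or_one a with ha | ha
    · rw [doubleCircleCcw_even ha, cyclicGap_of_gt h₁, cyclicGap_of_lt h₃]
      omega
    · rw [doubleCircleCcw_odd ha, cyclicGap_of_gt h₁, cyclicGap_of_lt h₃]
      omega
  · rw [← chainDet_rotate, chainDet_pos_iff_of_lt h₂ h₃]
    rcases Int.emod_two_eq_zero_or_one a with ha | ha
    · rw [doubleCircleCcw_even ha, cyclicGap_of_gt h₁, cyclicGap_of_gt h₃]
      omega
    · rw [doubleCircleCcw_odd ha, cyclicGap_of_gt h₁, cyclicGap_of_gt h₃]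
      omega
  · omega
  · rw [← chainDet_rotate, chainDet_swap, hneg h₂ h₁]
    rcases Int.emod_two_eq_zero_or_one a with ha | ha
    · rw [doubleCircleCcw_even ha, cyclicGap_of_gt h₁, cyclicGap_of_gt h₃]
      omega
    · rw [doubleCircleCcw_odd ha, cyclicGap_of_gt h₁, cyclicGap_of_gt h₃]
      omega

/-- Ranks do not change if some of the positions are shifted by `N`. -/
theorem radialRank_shift {N a b a' b' : ℤ} (hN₂ : N % 2 = 0)
    (ha' : a' = a ∨ a' = a + N) (hb' : b' = b ∨ b' = b + N) (hab : a ≠ b)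
    (h₁ : a < b + N) (h₂ : b < a + N) (h₃ : a' < b' + N) (h₄ : b' < a' + N) :
    radialRank N a' b' = radialRank N a b := by
  have hg : cyclicGap N a' b' = cyclicGap N a b := by
    have g₁ := cyclicGap_cases N a b
    have g₂ := cyclicGap_cases N a' b'
    omega
  have hp : a' % 2 = a % 2 := by omega
  unfold radialRank
  rw [hg, hp]

/-- The case of `u` as the third point around `a`. Since `u` has the last rank, the cyclic order
reduces to the left side; the right side is the majority rule, in which the orientations with `u`
are comparisons of positions along the chain. -/
theorem radialRank_lt_iff_of_chain {N a b c : ℤ} (hN : 6 ≤ N) (hab : a ≠ b) (hac : a ≠ c)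
    (hab₁ : a + 1 < b + N) (hab₂ : b + 1 < a + N) (hbc₁ : b + 1 < c + N)
    (hbc₂ : c + 1 < b + N) (hac₁ : a + 1 < c + N) (hac₂ : c + 1 < a + N) :
    radialRank N a b < radialRank N a c ↔
      (DoubleCircleCcw N a b c ∧ c < a) ∨ (c < a ∧ a < b) ∨ (a < b ∧ DoubleCircleCcw N a b c) := by
  have g₁ := cyclicGap_cases N a b
  have g₂ := cyclicGap_cases N a c
  rcases Int.emod_two_eq_zero_or_one a with ha | ha
  · rw [radialRank_lt_iff hN ha hab hac (by omega) (by omega) (by omega) (by omega),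
      doubleCircleCcw_even ha]
    rcases lt_or_gt_of_ne hab with h₁ | h₁ <;> rcases lt_or_gt_of_ne hac with h₂ | h₂ <;>
      simp only [h₁, h₂, h₁.not_gt, h₂.not_gt, and_true, and_false, true_and, false_and, or_false,
        false_or, true_or, or_true, or_self, iff_true, iff_false] <;> omega
  · rw [radialRank_odd ha, radialRank_odd ha, doubleCircleCcw_odd ha]
    rcases lt_or_gt_of_ne hab with h₁ | h₁ <;> rcases lt_or_gt_of_ne hac with h₂ | h₂ <;>
      simp only [h₁, h₂, h₁.not_gt, h₂.not_gt, and_true, and_false, true_and, false_and, or_false,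
        false_or, true_or, or_true, or_self, iff_true, iff_false] <;> omega

namespace DCVertex

variable {k : ℕ}

/-- The position along the boundary, starting after the point `r`. -/
def positionAfter (r y : Fin k ⊕ Fin k) : ℤ :=
  if position r < position y then position y else position y + 2 * k

theorem positionAfter_cases (r y : Fin k ⊕ Fin k) :
    positionAfter r y = position y ∨ positionAfter r y = position y + 2 * k := by
  unfold positionAfter
  split_ifs <;> simp

theorem lt_positionAfter (r y : Fin k ⊕ Fin k) : position r < positionAfter r y := by
  have := position_lt r; have := position_nonneg y
  unfold positionAfter
  split_ifs <;> omega

theorem positionAfter_lt {r y : Fin k ⊕ Fin k} (h : y ≠ r) :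
    positionAfter r y < position r + 2 * k := by
  have : position y ≠ position r := fun h' => h (position_injective h')
  have := position_lt y; have := position_nonneg r
  unfold positionAfter
  split_ifs <;> omega

theorem positionAfter_ne {r y z : Fin k ⊕ Fin k} (h : y ≠ z) :
    positionAfter r y ≠ positionAfter r z := by
  have : position y ≠ position z := fun h' => h (position_injective h')
  have := position_lt y; have := position_nonneg y
  have := position_lt z; have := position_nonneg z
  unfold positionAfter
  split_ifs <;> omega

/-- A point set realizing the radial system of the double circle with the additional label `u`,
without the point `r`: a convex chain with dents, seen by `u` from far below. -/
noncomputable def chainPoint (r : Fin k ⊕ Fin k) : DCVertex k → ℝ × ℝ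
  | some y => ((positionAfter r y : ℝ),
      -- At a number `t`, the chord over `t - 1` and `t + 1` lies `1` above the parabola. Raising
      -- the odd points by `3 / 2` puts them just beyond that chord.
      (positionAfter r y : ℝ) ^ 2 + 3 / 2 * ((positionAfter r y % 2 : ℤ) : ℝ))
  -- Positions are below `4 * k`, so this depth exceeds every product of the abscissa of one chain
  -- point and the ordinate of another. Thus `u` sees the chain ordered by abscissa.
  | none => (0, -(4 * k * ((4 * k) ^ 2 + 2) + 1))

theorem chainPoint_chirotope (r x y z : Fin k ⊕ Fin k) :
    pointChirotope (chainPoint r) (some x) (some y) (some z) = SignType.sign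
      (chainDet (positionAfter r x) (positionAfter r y) (positionAfter r z)) := by
  have h : ((((chainPoint r (some y)).1 - (chainPoint r (some x)).1) *
      ((chainPoint r (some z)).2 - (chainPoint r (some x)).2)
    - ((chainPoint r (some y)).2 - (chainPoint r (some x)).2) *
      ((chainPoint r (some z)).1 - (chainPoint r (some x)).1)) : ℝ) =
      (chainDet (positionAfter r x) (positionAfter r y) (positionAfter r z) : ℤ) / 2 := by
    simp only [chainPoint, chainDet]
    push_cast
    ring
  rw [pointChirotope, h]
  rcases lt_trichotomy 0 (chainDet (positionAfter r x) (positionAfter r y) (positionAfter r z))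
    with h' | h' | h'
  · rw [sign_pos h', sign_pos (by have : (0 : ℝ) < _ := Int.cast_pos.2 h'; linarith)]
  · rw [← h']
    simp
  · rw [sign_neg h', sign_neg (by have : _ < (0 : ℝ) := Int.cast_lt_zero.2 h'; linarith)]

theorem chainPoint_chirotope_u_of_lt {r x y : Fin k ⊕ Fin k} (hx : x ≠ r) (hy : y ≠ r)
    (h : positionAfter r x < positionAfter r y) :
    pointChirotope (chainPoint r) u (some x) (some y) = -1 := by
  rw [pointChirotope, sign_eq_neg_one_iff]
  have hxy : (positionAfter r x : ℝ) + 1 ≤ positionAfter r y := by exact_mod_cast h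
  have hx₀ : (0 : ℝ) ≤ positionAfter r x := by
    have := lt_positionAfter r x; have := position_nonneg r
    exact_mod_cast (by omega : (0 : ℤ) ≤ positionAfter r x)
  have hx₁ : (positionAfter r x : ℝ) ≤ 4 * k := by
    have := positionAfter_lt hx; have := position_lt r
    exact_mod_cast (by omega : positionAfter r x ≤ 4 * k)
  have hy₁ : (positionAfter r y : ℝ) ≤ 4 * k := by
    have := positionAfter_lt hy; have := position_lt r
    exact_mod_cast (by omega : positionAfter r y ≤ 4 * k)
  have ox : (0 : ℝ) ≤ ((positionAfter r x % 2 : ℤ) : ℝ) := by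
    exact_mod_cast (by omega : 0 ≤ positionAfter r x % 2)
  have oy : ((positionAfter r y % 2 : ℤ) : ℝ) ≤ 1 := by
    exact_mod_cast (by omega : positionAfter r y % 2 ≤ 1)
  have oy₀ : (0 : ℝ) ≤ ((positionAfter r y % 2 : ℤ) : ℝ) := by
    exact_mod_cast (by omega : 0 ≤ positionAfter r y % 2)
  simp only [chainPoint]
  generalize (positionAfter r x : ℝ) = a at *
  generalize (positionAfter r y : ℝ) = b at *
  generalize ((positionAfter r x % 2 : ℤ) : ℝ) = o at *
  generalize ((positionAfter r y % 2 : ℤ) : ℝ) = o' at *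
  generalize (4 * (k : ℝ)) = K at *
  have h₁ : a * (b ^ 2 + 3 / 2 * o') ≤ K * (K ^ 2 + 2) := by
    have : b ^ 2 ≤ K ^ 2 := by gcongr; linarith
    exact mul_le_mul hx₁ (by linarith) (by positivity) (by linarith)
  have h₂ : 0 ≤ b * (a ^ 2 + 3 / 2 * o) := mul_nonneg (by linarith) (by positivity)
  have hM : 0 < K * (K ^ 2 + 2) + 1 := by
    have : 0 ≤ K := hx₀.trans hx₁
    positivity
  nlinarith [mul_le_mul_of_nonneg_right hxy hM.le]

theorem chainPoint_chirotope_u {r x y : Fin k ⊕ Fin k} (hx : x ≠ r) (hy : y ≠ r) (hxy : x ≠ y) :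
    (pointChirotope (chainPoint r) u (some x) (some y) = 1 ↔
      positionAfter r y < positionAfter r x) ∧
      pointChirotope (chainPoint r) u (some x) (some y) ≠ 0 := by
  rcases lt_or_gt_of_ne (positionAfter_ne (r := r) hxy) with h | h
  · rw [chainPoint_chirotope_u_of_lt hx hy h]
    exact ⟨by simpa using h.le, by decide⟩
  · have h' := chainPoint_chirotope_u_of_lt hy hx h
    rw [← pointChirotope_rotate, pointChirotope_swap_left, pointChirotope_rotate, h']
    exact ⟨by simpa using h, by decide⟩

theorem chainPoint_chirotope_eq_one_iff (hk : 3 ≤ k) {r x y z : Fin k ⊕ Fin k} (hx : x ≠ r)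
    (hy : y ≠ r) (hz : z ≠ r) (hxy : x ≠ y) (hyz : y ≠ z) (hxz : x ≠ z) :
    pointChirotope (chainPoint r) (some x) (some y) (some z) = 1 ↔ DoubleCircleCcw (2 * k)
      (positionAfter r x) (positionAfter r y) (positionAfter r z) := by
  have := lt_positionAfter r x; have := positionAfter_lt hx
  have := lt_positionAfter r y; have := positionAfter_lt hy
  have := lt_positionAfter r z; have := positionAfter_lt hz
  rw [chainPoint_chirotope, sign_eq_one_iff]
  exact chainDet_pos_iff (by omega) (by omega) (positionAfter_ne hxy) (positionAfter_ne hyz)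
    (positionAfter_ne hxz) (by omega) (by omega) (by omega) (by omega) (by omega) (by omega)

theorem rank_eq_positionAfter {r x y : Fin k ⊕ Fin k} (hx : x ≠ r) (hy : y ≠ r) (hxy : x ≠ y) :
    rank (some x) (some y) =
      radialRank (2 * k) (positionAfter r x) (positionAfter r y) := by
  have := lt_positionAfter r x; have := positionAfter_lt hx
  have := lt_positionAfter r y; have := positionAfter_lt hy
  have := position_lt x; have := position_nonneg x
  have := position_lt y; have := position_nonneg y
  exact (radialRank_shift (by omega) (positionAfter_cases r x) (positionAfter_cases r y)
    (fun h => hxy (position_injective h)) (by omega) (by omega) (by omega) (by omega)).symm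

theorem ccwAround_chainPoint_some (hk : 3 ≤ k) {r x a b c : Fin k ⊕ Fin k} (hx : x ≠ r)
    (ha : a ≠ r) (hb : b ≠ r) (hc : c ≠ r) (hxa : x ≠ a) (hxb : x ≠ b) (hxc : x ≠ c)
    (hab : a ≠ b) (hbc : b ≠ c) (hac : a ≠ c) :
    CyclicLT (rank (some x) (some a)) (rank (some x) (some b)) (rank (some x) (some c)) ↔
      CcwAround (pointChirotope (chainPoint r)) (some x) (some a) (some b) (some c) := by
  have := lt_positionAfter r x; have := positionAfter_lt hx
  have := lt_positionAfter r a; have := positionAfter_lt ha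
  have := lt_positionAfter r b; have := positionAfter_lt hb
  have := lt_positionAfter r c; have := positionAfter_lt hc
  rw [rank_eq_positionAfter hx ha hxa, rank_eq_positionAfter hx hb hxb,
    rank_eq_positionAfter hx hc hxc, CcwAround,
    chainPoint_chirotope_eq_one_iff hk hx ha hb hxa hab hxb,
    chainPoint_chirotope_eq_one_iff hk hx hb hc hxb hbc hxc,
    chainPoint_chirotope_eq_one_iff hk hx hc ha hxc hac.symm hxa]
  apply cyclicLT_radialRank_iff <;> first | exact positionAfter_ne (by assumption) | omega

theorem ccwAround_chainPoint_u (hk : 3 ≤ k) {r x a b : Fin k ⊕ Fin k} (hx : x ≠ r)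
    (ha : a ≠ r) (hb : b ≠ r) (hxa : x ≠ a) (hxb : x ≠ b) (hab : a ≠ b) :
    CyclicLT (rank (some x) (some a)) (rank (some x) (some b)) (rank (some x) u) ↔
      CcwAround (pointChirotope (chainPoint r)) (some x) (some a) (some b) u := by
  have := lt_positionAfter r x; have := positionAfter_lt hx
  have := lt_positionAfter r a; have := positionAfter_lt ha
  have := lt_positionAfter r b; have := positionAfter_lt hb
  have h₁ := positionAfter_ne (r := r) hxa
  have h₂ := positionAfter_ne (r := r) hxb
  have m₁ := rank_mem hk hxa
  have m₂ := rank_mem hk hxb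
  have h : CyclicLT (rank (some x) (some a)) (rank (some x) (some b)) (rank (some x) u) ↔
      rank (some x) (some a) < rank (some x) (some b) := by
    simp only [rank, CyclicLT]
    omega
  rw [h, rank_eq_positionAfter hx ha hxa, rank_eq_positionAfter hx hb hxb, CcwAround,
    chainPoint_chirotope_eq_one_iff hk hx ha hb hxa hab hxb,
    pointChirotope_rotate _ u (some x) (some b), (chainPoint_chirotope_u hx hb hxb).1,
    ← pointChirotope_rotate _ (some x) u (some a), (chainPoint_chirotope_u ha hx hxa.symm).1]
  exact radialRank_lt_iff_of_chain (by omega) h₁ h₂ (by omega) (by omega) (by omega) (by omega)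
    (by omega) (by omega)

/-- Cutting at `r` moves the positions before `r` to the end, a rotation that preserves cyclic
order. -/
theorem ccwAround_u_chainPoint {r a b c : Fin k ⊕ Fin k} (ha : a ≠ r) (hb : b ≠ r) (hc : c ≠ r)
    (hab : a ≠ b) (hbc : b ≠ c) (hac : a ≠ c) :
    CyclicLT (rank u (some a)) (rank u (some b)) (rank u (some c)) ↔
      CcwAround (pointChirotope (chainPoint r)) u (some a) (some b) (some c) := by
  have ra : position a ≠ position r := fun h => ha (position_injective h)
  have rb : position b ≠ position r := fun h => hb (position_injective h)
  have rc : position c ≠ position r := fun h => hc (position_injective h)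
  have ab : position a ≠ position b := fun h => hab (position_injective h)
  have bc : position b ≠ position c := fun h => hbc (position_injective h)
  have ac : position a ≠ position c := fun h => hac (position_injective h)
  have := position_lt a; have := position_nonneg a
  have := position_lt b; have := position_nonneg b
  have := position_lt c; have := position_nonneg c
  rw [CcwAround, (chainPoint_chirotope_u ha hb hab).1, (chainPoint_chirotope_u hb hc hbc).1,
    (chainPoint_chirotope_u hc ha hac.symm).1]
  simp only [rank, CyclicLT, positionAfter]
  split_ifs <;> omega

end DCVertex

theorem generalPosition_chainPoint {k : ℕ} {S : Set (DCVertex k)} {r : Fin k ⊕ Fin k}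
    (hr : some r ∉ S) : GeneralPosition fun x : S => chainPoint r x.1 := by
  have hne : ∀ {x : Fin k ⊕ Fin k}, some x ∈ S → x ≠ r := by
    rintro x hx rfl
    exact hr hx
  have hu : ∀ x : Fin k ⊕ Fin k, chainPoint r (some x) ≠ chainPoint r none := by
    intro x h
    have h₂ := congrArg Prod.fst h
    simp only [chainPoint] at h₂
    have := lt_positionAfter r x; have := position_nonneg r
    have : positionAfter r x = 0 := by exact_mod_cast h₂
    omega
  constructor
  · rintro ⟨_ | x, hx⟩ ⟨_ | y, hy⟩ h
    · rfl
    · exact absurd h.symm (hu y)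
    · exact absurd h (hu x)
    · have h₁ := congrArg Prod.fst h
      simp only [chainPoint] at h₁
      have h₂ : positionAfter r x = positionAfter r y := by exact_mod_cast h₁
      by_contra hxy
      exact positionAfter_ne (fun e => hxy (by subst e; rfl)) h₂
  · rintro ⟨a, ha⟩ ⟨b, hb⟩ ⟨c, hc⟩ hab hbc hac
    change pointChirotope (chainPoint r) a b c ≠ 0
    replace hab : a ≠ b := fun e => hab (Subtype.ext e)
    replace hbc : b ≠ c := fun e => hbc (Subtype.ext e)
    replace hac : a ≠ c := fun e => hac (Subtype.ext e)
    have hs : ∀ {x y : Fin k ⊕ Fin k}, (some x : DCVertex k) ≠ some y → x ≠ y :=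
      fun h h' => h (congrArg some h')
    rcases a with _ | a <;> rcases b with _ | b <;> rcases c with _ | c
    · exact absurd rfl hab
    · exact absurd rfl hab
    · exact absurd rfl hac
    · exact (chainPoint_chirotope_u (hne hb) (hne hc) (hs hbc)).2
    · exact absurd rfl hbc
    · rw [← pointChirotope_rotate]
      exact (chainPoint_chirotope_u (hne hc) (hne ha) (hs hac.symm)).2
    · rw [pointChirotope_rotate]
      exact (chainPoint_chirotope_u (hne ha) (hne hb) (hs hab)).2
    · rw [chainPoint_chirotope, sign_ne_zero]
      exact chainDet_ne_zero (positionAfter_ne (hs hab)) (positionAfter_ne (hs hbc))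
        (positionAfter_ne (hs hac))

theorem induce_realizable_of_notMem_some {k : ℕ} (hk : 3 ≤ k) {S : Set (DCVertex k)}
    {r : Fin k ⊕ Fin k} (hr : some r ∉ S) :
    ((doubleCircleSystem hk).induce S).RealizableAsPointSet := by
  have hne : ∀ {x : Fin k ⊕ Fin k}, some x ∈ S → x ≠ r := by
    rintro x hx rfl
    exact hr hx
  refine ⟨fun x => chainPoint r x.1, generalPosition_chainPoint hr, ?_⟩
  rintro ⟨i, hi⟩ ⟨j, hj⟩ ⟨l, hl⟩ ⟨m, hm⟩ hji hli hmi hjl hlm hjm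
  rw [RadialSystem.induce, RadialSystem.comap_ccw, doubleCircleSystem_ccw]
  change (j ≠ i ∧ l ≠ i ∧ m ≠ i ∧ CyclicLT (rank i j) (rank i l) (rank i m)) ↔
    CcwAround (pointChirotope (chainPoint r)) i j l m
  replace hji : j ≠ i := fun e => hji (Subtype.ext e)
  replace hli : l ≠ i := fun e => hli (Subtype.ext e)
  replace hmi : m ≠ i := fun e => hmi (Subtype.ext e)
  replace hjl : j ≠ l := fun e => hjl (Subtype.ext e)
  replace hlm : l ≠ m := fun e => hlm (Subtype.ext e)
  replace hjm : j ≠ m := fun e => hjm (Subtype.ext e)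
  simp only [hji, hli, hmi, ne_eq, not_false_eq_true, true_and]
  have hs : ∀ {x y : Fin k ⊕ Fin k}, (some x : DCVertex k) ≠ some y → x ≠ y :=
    fun h h' => h (congrArg some h')
  rcases i with _ | i
  · rcases j with _ | j
    · exact absurd rfl hji
    rcases l with _ | l
    · exact absurd rfl hli
    rcases m with _ | m
    · exact absurd rfl hmi
    exact ccwAround_u_chainPoint (hne hj) (hne hl) (hne hm) (hs hjl) (hs hlm) (hs hjm)
  · rcases j with _ | j <;> rcases l with _ | l <;> rcases m with _ | m
    · exact absurd rfl hjl
    · exact absurd rfl hjl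
    · exact absurd rfl hjm
    · rw [CyclicLT.rotate_iff, CcwAround.rotate_iff]
      exact ccwAround_chainPoint_u hk (hne hi) (hne hl) (hne hm) (hs hli.symm) (hs hmi.symm)
        (hs hlm)
    · exact absurd rfl hlm
    · rw [← CyclicLT.rotate_iff, ← CcwAround.rotate_iff]
      exact ccwAround_chainPoint_u hk (hne hi) (hne hm) (hne hj) (hs hmi.symm) (hs hji.symm)
        (hs hjm.symm)
    · exact ccwAround_chainPoint_u hk (hne hi) (hne hj) (hne hl) (hs hji.symm) (hs hli.symm)
        (hs hjl)
    · exact ccwAround_chainPoint_some hk (hne hi) (hne hj) (hne hl) (hne hm) (hs hji.symm)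
        (hs hli.symm) (hs hmi.symm) (hs hjl) (hs hlm) (hs hjm)

/-! ### The vertex `u` is missing: orientations in the double circle for small `ε` -/

/-- Twice the oriented area of a triangle. -/
def triangleDet (A B C : ℝ × ℝ) : ℝ :=
  (B.1 - A.1) * (C.2 - A.2) - (B.2 - A.2) * (C.1 - A.1)

theorem triangleDet_rotate (A B C : ℝ × ℝ) : triangleDet B C A = triangleDet A B C := by
  unfold triangleDet; ring

theorem triangleDet_circle (x y z : ℝ) :
    triangleDet (Real.cos (2 * x), Real.sin (2 * x)) (Real.cos (2 * y), Real.sin (2 * y))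
      (Real.cos (2 * z), Real.sin (2 * z)) =
      4 * Real.sin (y - x) * Real.sin (z - y) * Real.sin (z - x) := by
  have h : triangleDet (Real.cos (2 * x), Real.sin (2 * x)) (Real.cos (2 * y), Real.sin (2 * y))
      (Real.cos (2 * z), Real.sin (2 * z)) =
      Real.sin (2 * (y - x)) + Real.sin (2 * (z - y)) -
        Real.sin (2 * (y - x) + 2 * (z - y)) := by
    have e : 2 * (y - x) + 2 * (z - y) = 2 * z - 2 * x := by ring
    rw [e, mul_sub, mul_sub, Real.sin_sub, Real.sin_sub, Real.sin_sub, triangleDet]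
    ring
  have e : z - x = (y - x) + (z - y) := by ring
  rw [h, e, Real.sin_add, Real.sin_add, Real.sin_two_mul, Real.sin_two_mul, Real.cos_two_mul',
    Real.cos_two_mul']
  generalize y - x = p
  generalize z - y = q
  linear_combination (-2 * Real.sin p * Real.cos p) * Real.sin_sq_add_cos_sq q -
    2 * Real.sin q * Real.cos q * Real.sin_sq_add_cos_sq p

theorem triangleDet_polygonVertex {k : ℕ} (a b c : ℕ) :
    triangleDet (polygonVertex k a) (polygonVertex k b) (polygonVertex k c) =
      4 * Real.sin (Real.pi * (((b : ℝ) - a) / k)) * Real.sin (Real.pi * (((c : ℝ) - b) / k)) *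
        Real.sin (Real.pi * (((c : ℝ) - a) / k)) := by
  have e : ∀ i : ℕ, 2 * Real.pi * i / k = 2 * (Real.pi * (i / k)) := fun i => by ring
  simp only [polygonVertex, e]
  rw [triangleDet_circle]
  congr 3 <;> ring_nf

theorem sin_pi_mul_div_nonneg {k a b : ℕ} (h : a ≤ b) (h' : b ≤ a + k) :
    0 ≤ Real.sin (Real.pi * (((b : ℝ) - a) / k)) := by
  have h₁ : (a : ℝ) ≤ b := by exact_mod_cast h
  have h₂ : (b : ℝ) ≤ a + k := by exact_mod_cast h'
  apply Real.sin_nonneg_of_nonneg_of_le_pi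
  · exact mul_nonneg Real.pi_pos.le (div_nonneg (by linarith) (Nat.cast_nonneg k))
  · exact mul_le_of_le_one_right Real.pi_pos.le (div_le_one_of_le₀ (by linarith) (Nat.cast_nonneg k))

theorem sin_pi_mul_div_pos {k a b : ℕ} (h : a < b) (h' : b < a + k) :
    0 < Real.sin (Real.pi * (((b : ℝ) - a) / k)) := by
  have h₁ : (a : ℝ) < b := by exact_mod_cast h
  have h₂ : (b : ℝ) < a + k := by exact_mod_cast h'
  have hk : (0 : ℝ) < k := by linarith
  apply Real.sin_pos_of_pos_of_lt_pi
  · exact mul_pos Real.pi_pos (div_pos (by linarith) hk)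
  · exact mul_lt_of_lt_one_right Real.pi_pos ((div_lt_one hk).2 (by linarith))

/-- Coincident indices, including `c = a + k`, are allowed: they occur when midpoints are expanded
into vertices. -/
theorem triangleDet_polygonVertex_nonneg {k a b c : ℕ} (hab : a ≤ b) (hbc : b ≤ c)
    (hc : c ≤ a + k) :
    0 ≤ triangleDet (polygonVertex k a) (polygonVertex k b) (polygonVertex k c) := by
  rw [triangleDet_polygonVertex]
  have h₁ := sin_pi_mul_div_nonneg hab (by omega : b ≤ a + k)
  have h₂ := sin_pi_mul_div_nonneg hbc (by omega : c ≤ b + k)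
  have h₃ := sin_pi_mul_div_nonneg (hab.trans hbc) hc
  positivity

theorem triangleDet_polygonVertex_pos {k a b c : ℕ} (hab : a < b) (hbc : b < c)
    (hc : c < a + k) :
    0 < triangleDet (polygonVertex k a) (polygonVertex k b) (polygonVertex k c) := by
  rw [triangleDet_polygonVertex]
  have h₁ := sin_pi_mul_div_pos hab (by omega : b < a + k)
  have h₂ := sin_pi_mul_div_pos hbc (by omega : c < b + k)
  have h₃ := sin_pi_mul_div_pos (hab.trans hbc) hc
  positivity

theorem polygonVertex_add_self {k : ℕ} (hk : k ≠ 0) (i : ℕ) :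
    polygonVertex k (i + k) = polygonVertex k i := by
  have hk' : (k : ℝ) ≠ 0 := Nat.cast_ne_zero.2 hk
  have e : 2 * Real.pi * ((i + k : ℕ) : ℝ) / k = 2 * Real.pi * i / k + 2 * Real.pi := by
    push_cast
    field_simp
  simp only [polygonVertex, e, Real.cos_add_two_pi, Real.sin_add_two_pi]

/-- The points of the double circle, numbered cyclically along its boundary. -/
noncomputable def boundaryPoint (k : ℕ) (ε : ℝ) (t : ℕ) : ℝ × ℝ :=
  if t % 2 = 0 then polygonVertex k (t / 2)
  else (1 - ε) • midpoint ℝ (polygonVertex k (t / 2)) (polygonVertex k (t / 2 + 1))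

theorem boundaryPoint_add_self {k : ℕ} (hk : k ≠ 0) (ε : ℝ) (t : ℕ) :
    boundaryPoint k ε (t + 2 * k) = boundaryPoint k ε t := by
  have h₁ : (t + 2 * k) % 2 = t % 2 := by omega
  have h₂ : (t + 2 * k) / 2 = t / 2 + k := by omega
  have h₃ : t / 2 + k + 1 = t / 2 + 1 + k := by omega
  unfold boundaryPoint
  rw [h₁, h₂, h₃, polygonVertex_add_self hk, polygonVertex_add_self hk]

theorem boundaryPoint_zero (k t : ℕ) :
    boundaryPoint k 0 t =
      midpoint ℝ (polygonVertex k (t / 2)) (polygonVertex k ((t + 1) / 2)) := by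
  unfold boundaryPoint
  split_ifs with h
  · rw [show (t + 1) / 2 = t / 2 by omega, midpoint_self]
  · rw [show (t + 1) / 2 = t / 2 + 1 by omega, sub_zero, one_smul]

theorem continuous_boundaryPoint (k t : ℕ) : Continuous fun ε => boundaryPoint k ε t := by
  unfold boundaryPoint
  split_ifs <;> fun_prop

theorem triangleDet_midpoint (A A' B B' C C' : ℝ × ℝ) :
    triangleDet (midpoint ℝ A A') (midpoint ℝ B B') (midpoint ℝ C C') =
      (triangleDet A B C + triangleDet A B C' + triangleDet A B' C + triangleDet A B' C' +
        triangleDet A' B C + triangleDet A' B C' + triangleDet A' B' C + triangleDet A' B' C') / 8 := by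
  simp only [triangleDet, midpoint_eq_smul_add, Prod.smul_fst, Prod.smul_snd, Prod.fst_add,
    Prod.snd_add, smul_eq_mul, invOf_eq_inv]
  ring

/-- At `ε = 0` each point is the midpoint of two, possibly equal, vertices, so the determinant is
the mean of eight polygon determinants. All are nonnegative because the indices are weakly ordered
within one turn, and outside the dent triples at least one index triple is strictly ordered. -/
theorem triangleDet_boundaryPoint_zero_pos {k t d d' : ℕ} (hk : 3 ≤ k) (hd : 0 < d) (hdd : d < d')
    (hd' : d' < 2 * k) (e₁ : ¬ (t % 2 = 0 ∧ d = 1 ∧ d' = 2))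
    (e₂ : ¬ (t % 2 = 0 ∧ d = 2 * k - 2 ∧ d' = 2 * k - 1))
    (e₃ : ¬ (t % 2 = 1 ∧ d = 1 ∧ d' = 2 * k - 1)) :
    0 < triangleDet (boundaryPoint k 0 t) (boundaryPoint k 0 (t + d))
      (boundaryPoint k 0 (t + d')) := by
  rw [boundaryPoint_zero, boundaryPoint_zero, boundaryPoint_zero, triangleDet_midpoint]
  obtain ⟨a, ha⟩ : ∃ a, t / 2 = a := ⟨_, rfl⟩
  obtain ⟨a', ha'⟩ : ∃ a, (t + 1) / 2 = a := ⟨_, rfl⟩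
  obtain ⟨b, hb⟩ : ∃ a, (t + d) / 2 = a := ⟨_, rfl⟩
  obtain ⟨b', hb'⟩ : ∃ a, (t + d + 1) / 2 = a := ⟨_, rfl⟩
  obtain ⟨c, hc⟩ : ∃ a, (t + d') / 2 = a := ⟨_, rfl⟩
  obtain ⟨c', hc'⟩ : ∃ a, (t + d' + 1) / 2 = a := ⟨_, rfl⟩
  rw [ha, ha', hb, hb', hc, hc']
  have h₁ := triangleDet_polygonVertex_nonneg (k := k) (a := a) (b := b) (c := c)
    (by omega) (by omega) (by omega)
  have h₂ := triangleDet_polygonVertex_nonneg (k := k) (a := a) (b := b) (c := c')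
    (by omega) (by omega) (by omega)
  have h₃ := triangleDet_polygonVertex_nonneg (k := k) (a := a) (b := b') (c := c)
    (by omega) (by omega) (by omega)
  have h₄ := triangleDet_polygonVertex_nonneg (k := k) (a := a) (b := b') (c := c')
    (by omega) (by omega) (by omega)
  have h₅ := triangleDet_polygonVertex_nonneg (k := k) (a := a') (b := b) (c := c)
    (by omega) (by omega) (by omega)
  have h₆ := triangleDet_polygonVertex_nonneg (k := k) (a := a') (b := b) (c := c')
    (by omega) (by omega) (by omega)
  have h₇ := triangleDet_polygonVertex_nonneg (k := k) (a := a') (b := b') (c := c)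
    (by omega) (by omega) (by omega)
  have h₈ := triangleDet_polygonVertex_nonneg (k := k) (a := a') (b := b') (c := c')
    (by omega) (by omega) (by omega)
  have h : (a < b ∧ b < c ∧ c < a + k) ∨ (a < b ∧ b < c' ∧ c' < a + k) ∨
      (a < b' ∧ b' < c ∧ c < a + k) ∨ (a < b' ∧ b' < c' ∧ c' < a + k) ∨
      (a' < b ∧ b < c ∧ c < a' + k) ∨ (a' < b ∧ b < c' ∧ c' < a' + k) ∨
      (a' < b' ∧ b' < c ∧ c < a' + k) ∨ (a' < b' ∧ b' < c' ∧ c' < a' + k) := by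
    omega
  rcases h with h | h | h | h | h | h | h | h <;>
    have := triangleDet_polygonVertex_pos h.1 h.2.1 h.2.2 <;> linarith

/-- A dent triple is collinear at `ε = 0`, so continuity says nothing; the determinant is exactly
`-ε * sin (2 * π / k)`. -/
theorem triangleDet_boundaryPoint_neg {k t : ℕ} (hk : 3 ≤ k) (ht : t % 2 = 0) {ε : ℝ} (hε : 0 < ε) :
    triangleDet (boundaryPoint k ε t) (boundaryPoint k ε (t + 1)) (boundaryPoint k ε (t + 2)) < 0 := by
  have h₁ : (t + 1) % 2 ≠ 0 := by omega
  have h₂ : (t + 2) % 2 = 0 := by omega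
  have h₃ : (t + 1) / 2 = t / 2 := by omega
  have h₄ : (t + 2) / 2 = t / 2 + 1 := by omega
  have hdet : triangleDet (boundaryPoint k ε t) (boundaryPoint k ε (t + 1))
      (boundaryPoint k ε (t + 2)) = -ε * Real.sin (2 * (Real.pi / k)) := by
    unfold boundaryPoint
    rw [if_pos ht, if_neg h₁, if_pos h₂, h₃, h₄]
    have e : 2 * (Real.pi / k) =
        2 * Real.pi * ((t / 2 + 1 : ℕ) : ℝ) / k - 2 * Real.pi * ((t / 2 : ℕ) : ℝ) / k := by
      push_cast
      ring
    rw [e, Real.sin_sub]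
    simp only [triangleDet, polygonVertex, midpoint_eq_smul_add, Prod.smul_fst, Prod.smul_snd,
      Prod.fst_add, Prod.snd_add, smul_eq_mul, invOf_eq_inv]
    ring
  rw [hdet]
  have hk' : (3 : ℝ) ≤ k := by exact_mod_cast hk
  have : 0 < Real.sin (2 * (Real.pi / k)) := by
    apply Real.sin_pos_of_pos_of_lt_pi
    · have := Real.pi_pos
      positivity
    · rw [← mul_div_assoc, div_lt_iff₀ (by linarith)]
      nlinarith [Real.pi_pos]
  nlinarith

theorem eventually_sign_triangleDet_boundaryPoint {k t d d' : ℕ} (hk : 3 ≤ k) (hd : 0 < d)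
    (hdd : d < d') (hd' : d' < 2 * k) : ∀ᶠ ε in 𝓝[>] (0 : ℝ),
    SignType.sign (triangleDet (boundaryPoint k ε t) (boundaryPoint k ε (t + d))
      (boundaryPoint k ε (t + d'))) =
      if (t % 2 = 0 ∧ d = 1 ∧ d' = 2) ∨ (t % 2 = 0 ∧ d = 2 * k - 2 ∧ d' = 2 * k - 1) ∨
        (t % 2 = 1 ∧ d = 1 ∧ d' = 2 * k - 1) then -1 else 1 := by
  have hpos : ∀ᶠ ε in 𝓝[>] (0 : ℝ), 0 < ε := self_mem_nhdsWithin
  split_ifs with h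
  · filter_upwards [hpos] with ε hε
    rw [sign_eq_neg_one_iff]
    rcases h with ⟨ht, rfl, rfl⟩ | ⟨ht, rfl, rfl⟩ | ⟨ht, rfl, rfl⟩
    · exact triangleDet_boundaryPoint_neg hk ht hε
    · have := triangleDet_boundaryPoint_neg (t := t + (2 * k - 2)) hk (by omega) hε
      rw [show t + (2 * k - 2) + 2 = t + 2 * k by omega, boundaryPoint_add_self (by omega),
        show t + (2 * k - 2) + 1 = t + (2 * k - 1) by omega, triangleDet_rotate] at this
      exact this
    · have := triangleDet_boundaryPoint_neg (t := t + (2 * k - 1)) hk (by omega) hε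
      rw [show t + (2 * k - 1) + 1 = t + 2 * k by omega, boundaryPoint_add_self (by omega),
        show t + (2 * k - 1) + 2 = t + 1 + 2 * k by omega, boundaryPoint_add_self (by omega),
        ← triangleDet_rotate] at this
      exact this
  · rw [not_or, not_or] at h
    have h₀ := triangleDet_boundaryPoint_zero_pos (t := t) hk hd hdd hd' h.1 h.2.1 h.2.2
    have hc : Continuous fun ε => triangleDet (boundaryPoint k ε t) (boundaryPoint k ε (t + d))
        (boundaryPoint k ε (t + d')) := by
      have := continuous_boundaryPoint k t
      have := continuous_boundaryPoint k (t + d)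
      have := continuous_boundaryPoint k (t + d')
      unfold triangleDet
      fun_prop
    filter_upwards [(continuousAt_const.eventually_lt hc.continuousAt h₀).filter_mono
      nhdsWithin_le_nhds] with ε hε
    exact sign_pos hε

theorem doubleCircle_eq_boundaryPoint {k : ℕ} (ε : ℝ) (x : Fin k ⊕ Fin k) :
    doubleCircle k ε x = boundaryPoint k ε (position x).toNat := by
  rcases x with i | i
  · have h₁ : (position (Sum.inl i)).toNat = 2 * (i : ℕ) := by simp only [position]; omega
    rw [h₁, boundaryPoint, if_pos (by omega), show 2 * (i : ℕ) / 2 = i by omega]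
    rfl
  · have h₁ : (position (Sum.inr i)).toNat = 2 * (i : ℕ) + 1 := by simp only [position]; omega
    rw [h₁, boundaryPoint, if_neg (by omega), show (2 * (i : ℕ) + 1) / 2 = i by omega]
    rfl

theorem doubleCircle_eq_boundaryPoint_gap {k : ℕ} (hk : 3 ≤ k) (ε : ℝ) (x y : Fin k ⊕ Fin k) :
    doubleCircle k ε y = boundaryPoint k ε
      ((position x).toNat + (cyclicGap (2 * k) (position x) (position y)).toNat) := by
  have := position_lt x; have := position_nonneg x
  have := position_lt y; have := position_nonneg y
  rw [doubleCircle_eq_boundaryPoint]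
  rcases cyclicGap_cases (2 * k) (position x) (position y) with ⟨h, h'⟩ | ⟨h, h'⟩
  · congr 1
    omega
  · rw [← boundaryPoint_add_self (by omega)]
    congr 1
    omega

theorem eventually_pointChirotope_doubleCircle_of_gap_lt {k : ℕ} (hk : 3 ≤ k)
    {x y z : Fin k ⊕ Fin k} (hxy : x ≠ y) (hxz : x ≠ z)
    (h : cyclicGap (2 * k) (position x) (position y) < cyclicGap (2 * k) (position x) (position z)) :
    ∀ᶠ ε in 𝓝[>] (0 : ℝ),
      ((pointChirotope (doubleCircle k ε) x y z = 1 ↔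
        DoubleCircleCcw (2 * k) (position x) (position y) (position z)) ∧
      (pointChirotope (doubleCircle k ε) x z y = 1 ↔
        DoubleCircleCcw (2 * k) (position x) (position z) (position y)) ∧
      pointChirotope (doubleCircle k ε) x y z ≠ 0) := by
  have := position_lt x; have := position_nonneg x
  have := position_lt y; have := position_nonneg y
  have := position_lt z; have := position_nonneg z
  have hxy' : position x ≠ position y := fun h => hxy (position_injective h)
  have hxz' : position x ≠ position z := fun h => hxz (position_injective h)
  have g₁ := cyclicGap_cases (2 * k) (position x) (position y)
  have g₂ := cyclicGap_cases (2 * k) (position x) (position z)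
  filter_upwards [eventually_sign_triangleDet_boundaryPoint (t := (position x).toNat)
    (d := (cyclicGap (2 * k) (position x) (position y)).toNat)
    (d' := (cyclicGap (2 * k) (position x) (position z)).toNat) hk (by omega) (by omega)
    (by omega)] with ε hε
  rw [← doubleCircle_eq_boundaryPoint_gap hk, ← doubleCircle_eq_boundaryPoint_gap hk,
    ← doubleCircle_eq_boundaryPoint] at hε
  have hε' : pointChirotope (doubleCircle k ε) x y z = _ := hε
  have hswap : pointChirotope (doubleCircle k ε) x z y = -pointChirotope (doubleCircle k ε) x y z := by
    rw [← pointChirotope_rotate, ← pointChirotope_rotate, pointChirotope_swap_left]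
  rw [hswap, hε']
  clear hswap hε hε'
  have k₁ : 1 ≤ cyclicGap (2 * k) (position x) (position y) := by omega
  have k₂ : cyclicGap (2 * k) (position x) (position z) < 2 * k := by omega
  clear g₁ g₂
  have n₂ : -(-1 : SignType) = 1 ↔ True := by decide
  rcases Int.emod_two_eq_zero_or_one (position x) with hp | hp
  · rw [doubleCircleCcw_even hp, doubleCircleCcw_even hp]
    generalize cyclicGap (2 * k) (position x) (position y) = d at *
    generalize cyclicGap (2 * k) (position x) (position z) = d' at *
    split_ifs with hif
    · simp only [n₂, false_iff, true_iff]
      exact ⟨by omega, by omega, by decide⟩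
    · simp only [false_iff, true_iff]
      exact ⟨by omega, by omega, by decide⟩
  · rw [doubleCircleCcw_odd hp, doubleCircleCcw_odd hp]
    generalize cyclicGap (2 * k) (position x) (position y) = d at *
    generalize cyclicGap (2 * k) (position x) (position z) = d' at *
    split_ifs with hif
    · simp only [n₂, false_iff, true_iff]
      exact ⟨by omega, by omega, by decide⟩
    · simp only [false_iff, true_iff]
      exact ⟨by omega, by omega, by decide⟩

theorem eventually_pointChirotope_doubleCircle {k : ℕ} (hk : 3 ≤ k) :
    ∀ᶠ ε in 𝓝[>] (0 : ℝ), ∀ x y z : Fin k ⊕ Fin k, x ≠ y → y ≠ z → x ≠ z →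
      ((pointChirotope (doubleCircle k ε) x y z = 1 ↔
        DoubleCircleCcw (2 * k) (position x) (position y) (position z)) ∧
      pointChirotope (doubleCircle k ε) x y z ≠ 0) := by
  rw [eventually_all]; intro x
  rw [eventually_all]; intro y
  rw [eventually_all]; intro z
  by_cases h : x ≠ y ∧ y ≠ z ∧ x ≠ z
  · obtain ⟨hxy, hyz, hxz⟩ := h
    have hyz' : position y ≠ position z := fun h => hyz (position_injective h)
    have := position_lt y; have := position_nonneg y
    have := position_lt z; have := position_nonneg z
    have hne : cyclicGap (2 * k) (position x) (position y) ≠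
        cyclicGap (2 * k) (position x) (position z) := by
      have g₁ := cyclicGap_cases (2 * k) (position x) (position y)
      have g₂ := cyclicGap_cases (2 * k) (position x) (position z)
      omega
    rcases lt_or_gt_of_ne hne with h | h
    · filter_upwards [eventually_pointChirotope_doubleCircle_of_gap_lt hk hxy hxz h]
        with ε hε _ _ _
      exact ⟨hε.1, hε.2.2⟩
    · filter_upwards [eventually_pointChirotope_doubleCircle_of_gap_lt hk hxz hxy h]
        with ε hε _ _ _
      refine ⟨hε.2.1, ?_⟩
      rw [← pointChirotope_rotate, ← pointChirotope_rotate, pointChirotope_swap_left]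
      have hneg : ∀ s : SignType, -s = 0 → s = 0 := by decide
      exact fun h => hε.2.2 (hneg _ h)
  · filter_upwards with ε h₁ h₂ h₃
    exact absurd ⟨h₁, h₂, h₃⟩ h

theorem eventually_isRealizedByPoints_doubleCircle {k : ℕ} (hk : 3 ≤ k) :
    ∀ᶠ ε in 𝓝[>] (0 : ℝ), ((doubleCircleSystem hk).comap
      Function.Embedding.some).IsRealizedByPoints (doubleCircle k ε) := by
  filter_upwards [eventually_pointChirotope_doubleCircle hk] with ε hε
  refine ⟨⟨fun a b h => ?_, fun a b c hab hbc hac => (hε a b c hab hbc hac).2⟩, ?_⟩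
  -- Two coinciding points would make every triple containing both degenerate; a third point exists
  -- as there are at least six.
  · by_contra hab
    obtain ⟨c, hca, hcb⟩ : ∃ c : Fin k ⊕ Fin k, c ≠ a ∧ c ≠ b := by
      obtain ⟨t, h₀, h₁, ha, hb⟩ : ∃ t : ℤ, 0 ≤ t ∧ t < 2 * k ∧ t ≠ position a ∧ t ≠ position b := by
        by_cases h₀ : position a ≠ 0 ∧ position b ≠ 0
        · exact ⟨0, by omega⟩
        by_cases h₁ : position a ≠ 1 ∧ position b ≠ 1
        · exact ⟨1, by omega⟩
        exact ⟨2, by omega⟩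
      obtain ⟨c, rfl⟩ := exists_position_eq h₀ h₁
      exact ⟨c, fun h => ha (by rw [h]), fun h => hb (by rw [h])⟩
    refine (hε a b c hab hcb.symm hca.symm).2 ?_
    simp [pointChirotope, h]
  · intro i j l m hj hl hm hjl hlm hjm
    have := position_lt i; have := position_nonneg i
    have := position_lt j; have := position_nonneg j
    have := position_lt l; have := position_nonneg l
    have := position_lt m; have := position_nonneg m
    have hne : ∀ {x y : Fin k ⊕ Fin k}, x ≠ y → position x ≠ position y :=
      fun h h' => h (position_injective h')
    rw [RadialSystem.comap_ccw, doubleCircleSystem_ccw, CcwAround, (hε i j l hj.symm hjl hl.symm).1,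
      (hε i l m hl.symm hlm hm.symm).1, (hε i m j hm.symm hjm.symm hj.symm).1]
    rw [← cyclicLT_radialRank_iff (by omega) (hne hj.symm) (hne hl.symm) (hne hm.symm) (hne hjl)
      (hne hlm) (hne hjm) (by omega) (by omega) (by omega) (by omega) (by omega) (by omega)
      (by omega) (by omega) (by omega) (by omega) (by omega) (by omega)]
    have hs : ∀ {x y : Fin k ⊕ Fin k}, x ≠ y →
        Function.Embedding.some x ≠ Function.Embedding.some y :=
      fun h => Function.Embedding.some.injective.ne h
    simp only [hs hj, hs hl, hs hm, ne_eq, not_false_eq_true, true_and]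
    rfl

/-! ### Proper subsets are realizable -/

theorem RadialSystem.IsRealizedByPoints.comap {V W : Type*} {R : RadialSystem V} {p : V → ℝ × ℝ}
    (h : R.IsRealizedByPoints p) (f : W ↪ V) : (R.comap f).IsRealizedByPoints (p ∘ f) :=
  ⟨⟨h.1.1.comp f.injective, fun a b c hab hbc hac =>
      h.1.2 (f a) (f b) (f c) (f.injective.ne hab) (f.injective.ne hbc) (f.injective.ne hac)⟩,
    fun i j l m hj hl hm hjl hlm hjm => RadialSystem.comap_ccw.trans
      (h.2 (f i) (f j) (f l) (f m) (f.injective.ne hj) (f.injective.ne hl) (f.injective.ne hm)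
        (f.injective.ne hjl) (f.injective.ne hlm) (f.injective.ne hjm))⟩

theorem induce_realizable_of_notMem_none {k : ℕ} (hk : 3 ≤ k) {S : Set (DCVertex k)}
    (hS : none ∉ S) : ((doubleCircleSystem hk).induce S).RealizableAsPointSet := by
  obtain ⟨ε, hε⟩ := (eventually_isRealizedByPoints_doubleCircle hk).exists
  have hsome : ∀ x : S, ∃ y : Fin k ⊕ Fin k, some y = x.1 := by
    rintro ⟨_ | y, hy⟩
    · exact absurd hy hS
    · exact ⟨y, rfl⟩
  choose g hg using hsome
  let f : S ↪ Fin k ⊕ Fin k := ⟨g, fun x y h => Subtype.ext (by rw [← hg x, ← hg y, h])⟩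
  have h := hε.comap f
  refine ⟨_, h.1, fun i j l m hj hl hm hjl hlm hjm => ?_⟩
  rw [← h.2 i j l m hj hl hm hjl hlm hjm, RadialSystem.induce, RadialSystem.comap_ccw,
    RadialSystem.comap_ccw, RadialSystem.comap_ccw]
  change (doubleCircleSystem hk).Ccw i.1 j.1 l.1 m.1 ↔
    (doubleCircleSystem hk).Ccw (some (g i)) (some (g j)) (some (g l)) (some (g m))
  rw [hg, hg, hg, hg]

theorem doubleCircleSystem_induce_realizable {k : ℕ} (hk : 3 ≤ k) {S : Set (DCVertex k)}
    (hS : S ≠ Set.univ) : ((doubleCircleSystem hk).induce S).RealizableAsPointSet := by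
  obtain ⟨x, hx⟩ := (Set.ne_univ_iff_exists_notMem S).1 hS
  rcases x with _ | r
  · exact induce_realizable_of_notMem_none hk hx
  · exact induce_realizable_of_notMem_some hk hx

/-! ### From point sets to generalized configurations -/

theorem crossOnce_of_slope_ne {m₁ m₂ c₁ c₂ : ℝ} (h : m₁ ≠ m₂) :
    CrossOnce (fun x => m₁ * x + c₁) (fun x => m₂ * x + c₂) := by
  have hd : m₁ - m₂ ≠ 0 := sub_ne_zero.2 h
  obtain ⟨x₀, hx₀⟩ : ∃ x₀, (m₁ - m₂) * x₀ = c₂ - c₁ := ⟨(c₂ - c₁) / (m₁ - m₂), by field_simp⟩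
  refine ⟨x₀, by linear_combination hx₀, ?_⟩
  rcases lt_or_gt_of_ne h with h | h
  · exact Or.inr ⟨fun x hx => by nlinarith, fun x hx => by nlinarith⟩
  · exact Or.inl ⟨fun x hx => by nlinarith, fun x hx => by nlinarith⟩

/-- Uniqueness of binary expansions. It makes the chord slopes of the perturbing points distinct. -/
theorem two_pow_add_two_pow_inj {a b c d : ℕ} (hab : a ≠ b) (hcd : c ≠ d)
    (h : 2 ^ a + 2 ^ b = 2 ^ c + 2 ^ d) : (a = c ∧ b = d) ∨ (a = d ∧ b = c) := by
  have hs : ∑ i ∈ ({a, b} : Finset ℕ), 2 ^ i = ∑ i ∈ ({c, d} : Finset ℕ), 2 ^ i := by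
    rw [Finset.sum_pair hab, Finset.sum_pair hcd, h]
  have he : ({a, b} : Finset ℕ) = {c, d} := Finset.geomSum_injective le_rfl hs
  have he' : ({a, b} : Set ℕ) = {c, d} := by simpa using congrArg (fun s : Finset ℕ => (s : Set ℕ)) he
  exact Set.pair_eq_pair_iff.1 he'

/-- A nonzero quadratic polynomial has no small positive roots. -/
theorem eventually_quadratic_ne_zero {c₀ c₁ c₂ : ℝ} (h : c₀ ≠ 0 ∨ c₁ ≠ 0 ∨ c₂ ≠ 0) :
    ∀ᶠ ε in 𝓝[>] (0 : ℝ), c₀ + c₁ * ε + c₂ * ε ^ 2 ≠ 0 := by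
  have hc : ∀ f : ℝ → ℝ, Continuous f → f 0 ≠ 0 → ∀ᶠ ε in 𝓝[>] (0 : ℝ), f ε ≠ 0 := fun f hf h0 =>
    (hf.continuousAt.eventually_ne h0).filter_mono nhdsWithin_le_nhds
  have hpos : ∀ᶠ ε in 𝓝[>] (0 : ℝ), 0 < ε := self_mem_nhdsWithin
  by_cases h₀ : c₀ = 0
  · by_cases h₁ : c₁ = 0
    · have h₂ : c₂ ≠ 0 := by tauto
      filter_upwards [hpos] with ε hε
      rw [h₀, h₁, zero_mul, zero_add, zero_add]
      positivity
    · filter_upwards [hpos, hc (fun ε => c₁ + c₂ * ε) (by fun_prop) (by simpa using h₁)] with ε hε hn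
      have : c₀ + c₁ * ε + c₂ * ε ^ 2 = ε * (c₁ + c₂ * ε) := by rw [h₀]; ring
      rw [this]
      exact mul_ne_zero hε.ne' hn
  · exact hc _ (by fun_prop) (by simpa using h₀)

theorem eventually_sign_eq {f : ℝ → ℝ} (hf : Continuous f) (h : f 0 ≠ 0) :
    ∀ᶠ ε in 𝓝[>] (0 : ℝ), SignType.sign (f ε) = SignType.sign (f 0) := by
  refine Eventually.filter_mono nhdsWithin_le_nhds ?_
  rcases lt_or_gt_of_ne h with h | h
  · filter_upwards [hf.continuousAt.eventually_lt continuousAt_const h] with ε hε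
    rw [sign_neg h, sign_neg hε]
  · filter_upwards [continuousAt_const.eventually_lt hf.continuousAt h] with ε hε
    rw [sign_pos h, sign_pos hε]

/-- The generalized configuration with straight lines of a point set in general position,
no two of whose connecting lines are parallel or vertical. -/
noncomputable def GeneralizedConfiguration.ofPoints {V : Type*} (p : V → ℝ × ℝ)
    (hp : GeneralPosition p) (hx : ∀ a b, a ≠ b → (p b).1 - (p a).1 ≠ 0)
    (hs : ∀ a b c d, a ≠ b → c ≠ d → s(a, b) ≠ s(c, d) →
      ((p b).2 - (p a).2) * ((p d).1 - (p c).1) - ((p d).2 - (p c).2) * ((p b).1 - (p a).1) ≠ 0) :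
    GeneralizedConfiguration V where
  pt := p
  pt_injective := hp.1
  -- The line is written through the midpoint of the two points, which makes the formula symmetric
  -- in them.
  line := Sym2.lift ⟨fun a b x => ((p b).2 - (p a).2) / ((p b).1 - (p a).1) * x +
      (((p a).2 + (p b).2) / 2 - ((p b).2 - (p a).2) / ((p b).1 - (p a).1) *
        (((p a).1 + (p b).1) / 2)), fun a b => by
    funext x
    beta_reduce
    rw [← neg_sub (p b).2 (p a).2, ← neg_sub (p b).1 (p a).1, neg_div_neg_eq]
    ring⟩
  continuous_line e _ := by
    induction e with
    | _ a b => simp only [Sym2.lift_mk]; fun_prop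
  mem_line_iff e he c := by
    induction e with
    | _ a b =>
      have hab : a ≠ b := by simpa using he
      have hxab := hx a b hab
      rw [Sym2.lift_mk, Sym2.mem_iff]
      constructor
      · intro h
        by_contra hc
        rw [not_or] at hc
        refine hp.2 a b c hab (Ne.symm hc.2) (Ne.symm hc.1) ?_
        rw [pointChirotope, sign_eq_zero_iff]
        field_simp at h
        linear_combination h / 2
      · rintro (rfl | rfl)
        · field_simp
          ring
        · field_simp
          ring
  crossOnce e f he hf hef := by
    induction e with
    | _ a b =>
    induction f with
    | _ c d =>
      have hab : a ≠ b := by simpa using he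
      have hcd : c ≠ d := by simpa using hf
      simp only [Sym2.lift_mk]
      refine crossOnce_of_slope_ne fun h => hs a b c d hab hcd hef ?_
      rw [div_eq_div_iff (hx a b hab) (hx c d hcd)] at h
      exact sub_eq_zero.2 h

theorem GeneralizedConfiguration.ofPoints_chirotope {V : Type*} {p : V → ℝ × ℝ}
    {hp : GeneralPosition p} {hx : ∀ a b, a ≠ b → (p b).1 - (p a).1 ≠ 0}
    {hs : ∀ a b c d, a ≠ b → c ≠ d → s(a, b) ≠ s(c, d) →
      ((p b).2 - (p a).2) * ((p d).1 - (p c).1) - ((p d).2 - (p c).2) * ((p b).1 - (p a).1) ≠ 0}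
    {a b c : V} (hab : a ≠ b) :
    (ofPoints p hp hx hs).chirotope a b c = pointChirotope p a b c := by
  have := hx a b hab
  simp only [chirotope, ofPoints, pointChirotope, Sym2.lift_mk]
  congr 1
  field_simp
  ring

/-- Every labeled point set in general position has the same chirotope as one without parallel or
vertical connecting lines. -/
theorem exists_generic_points {V : Type*} [Finite V] {p : V → ℝ × ℝ} (hp : GeneralPosition p) :
    ∃ p' : V → ℝ × ℝ, GeneralPosition p' ∧ (∀ a b, a ≠ b → (p' b).1 - (p' a).1 ≠ 0) ∧
      (∀ a b c d, a ≠ b → c ≠ d → s(a, b) ≠ s(c, d) → ((p' b).2 - (p' a).2) *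
        ((p' d).1 - (p' c).1) - ((p' d).2 - (p' c).2) * ((p' b).1 - (p' a).1) ≠ 0) ∧
      ∀ a b c, a ≠ b → b ≠ c → a ≠ c → pointChirotope p' a b c = pointChirotope p a b c := by
  obtain ⟨n, hn⟩ := exists_injective_nat V
  have hpow : ∀ a b, a ≠ b → (2 : ℝ) ^ n b - 2 ^ n a ≠ 0 := fun a b h h' => h (hn
    (Nat.pow_right_injective (le_refl 2) (by exact_mod_cast (sub_eq_zero.1 h').symm)))
  -- Perturbation by points of a parabola with abscissas `2 ^ n a`. The chord over `a` and `b` has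
  -- slope `2 ^ n a + 2 ^ n b`, so different pairs have different slopes. Hence the coefficient of
  -- `ε ^ 2` in each parallelism condition is nonzero.
  let P : ℝ → V → ℝ × ℝ := fun ε a => ((p a).1 + ε * 2 ^ n a, (p a).2 + ε * (2 ^ n a) ^ 2)
  have h₁ : ∀ᶠ ε in 𝓝[>] (0 : ℝ), ∀ a b, a ≠ b → (P ε b).1 - (P ε a).1 ≠ 0 := by
    rw [eventually_all]; intro a
    rw [eventually_all]; intro b
    by_cases hab : a = b
    · simp [hab]
    filter_upwards [eventually_quadratic_ne_zero (c₀ := (p b).1 - (p a).1)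
      (c₁ := 2 ^ n b - 2 ^ n a) (c₂ := 0) (Or.inr (Or.inl (hpow a b hab)))] with ε h _ h'
    exact h (by simp only [P] at h'; linear_combination h')
  have h₂ : ∀ᶠ ε in 𝓝[>] (0 : ℝ), ∀ a b c d, a ≠ b → c ≠ d → s(a, b) ≠ s(c, d) →
      ((P ε b).2 - (P ε a).2) * ((P ε d).1 - (P ε c).1) -
        ((P ε d).2 - (P ε c).2) * ((P ε b).1 - (P ε a).1) ≠ 0 := by
    rw [eventually_all]; intro a
    rw [eventually_all]; intro b
    rw [eventually_all]; intro c
    rw [eventually_all]; intro d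
    by_cases hab : a = b
    · simp [hab]
    by_cases hcd : c = d
    · simp [hcd]
    by_cases he : s(a, b) = s(c, d)
    · simp [he]
    have hsum : ((2 : ℝ) ^ n a + 2 ^ n b) - (2 ^ n c + 2 ^ n d) ≠ 0 := by
      intro h
      apply he
      have h' : 2 ^ n a + 2 ^ n b = 2 ^ n c + 2 ^ n d := by exact_mod_cast sub_eq_zero.1 h
      rw [Sym2.eq_iff]
      rcases two_pow_add_two_pow_inj (hn.ne hab) (hn.ne hcd) h' with h | h
      · exact Or.inl ⟨hn h.1, hn h.2⟩
      · exact Or.inr ⟨hn h.1, hn h.2⟩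
    filter_upwards [eventually_quadratic_ne_zero
      (c₀ := ((p b).2 - (p a).2) * ((p d).1 - (p c).1) - ((p d).2 - (p c).2) * ((p b).1 - (p a).1))
      (c₁ := ((p b).2 - (p a).2) * (2 ^ n d - 2 ^ n c) +
        ((2 ^ n b) ^ 2 - (2 ^ n a) ^ 2) * ((p d).1 - (p c).1) -
        ((p d).2 - (p c).2) * (2 ^ n b - 2 ^ n a) -
        ((2 ^ n d) ^ 2 - (2 ^ n c) ^ 2) * ((p b).1 - (p a).1))
      (c₂ := (2 ^ n b - 2 ^ n a) * (2 ^ n d - 2 ^ n c) *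
        (((2 : ℝ) ^ n a + 2 ^ n b) - (2 ^ n c + 2 ^ n d)))
      (Or.inr (Or.inr (mul_ne_zero (mul_ne_zero (hpow a b hab) (hpow c d hcd)) hsum)))]
      with ε h _ _ _ h'
    exact h (by simp only [P] at h'; linear_combination h')
  have h₃ : ∀ᶠ ε in 𝓝[>] (0 : ℝ), ∀ a b c, a ≠ b → b ≠ c → a ≠ c →
      pointChirotope (P ε) a b c = pointChirotope p a b c := by
    rw [eventually_all]; intro a
    rw [eventually_all]; intro b
    rw [eventually_all]; intro c
    by_cases h : a ≠ b ∧ b ≠ c ∧ a ≠ c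
    · have h0 : P 0 = p := by funext x; simp [P]
      have hne := hp.2 a b c h.1 h.2.1 h.2.2
      have := eventually_sign_eq (f := fun ε => ((P ε b).1 - (P ε a).1) * ((P ε c).2 - (P ε a).2)
        - ((P ε b).2 - (P ε a).2) * ((P ε c).1 - (P ε a).1)) (by simp only [P]; fun_prop) (by
          rw [h0]
          exact sign_ne_zero.1 hne)
      filter_upwards [this] with ε hε _ _ _
      rw [h0] at hε
      exact hε
    · filter_upwards with ε x y z
      exact absurd ⟨x, y, z⟩ h
  obtain ⟨ε, e₁, e₂, e₃⟩ := (h₁.and (h₂.and h₃)).exists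
  refine ⟨P ε, ⟨fun a b h => ?_, fun a b c x y z => ?_⟩, e₁, e₂, e₃⟩
  · by_contra hab
    exact e₁ a b hab (by rw [h, sub_self])
  · rw [e₃ a b c x y z]
    exact hp.2 a b c x y z

theorem RadialSystem.RealizableAsPointSet.realizableAsAbstractOrderType {V : Type*} [Finite V]
    {R : RadialSystem V} (h : R.RealizableAsPointSet) : R.RealizableAsAbstractOrderType := by
  obtain ⟨p, hp, hR⟩ := h
  obtain ⟨p', hp', hx, hs, hχ⟩ := exists_generic_points hp
  refine ⟨GeneralizedConfiguration.ofPoints p' hp' hx hs, fun i j l m hj hl hm hjl hlm hjm => ?_⟩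
  rw [hR i j l m hj hl hm hjl hlm hjm, CcwAround, CcwAround,
    GeneralizedConfiguration.ofPoints_chirotope hj.symm,
    GeneralizedConfiguration.ofPoints_chirotope hl.symm,
    GeneralizedConfiguration.ofPoints_chirotope hm.symm,
    hχ i j l hj.symm hjl hl.symm, hχ i l m hl.symm hlm hm.symm, hχ i m j hm.symm hjm.symm hj.symm]

/-! ### The main theorem -/

theorem card_DCVertex (k : ℕ) : Fintype.card (DCVertex k) = 2 * k + 1 := by
  simp [DCVertex, two_mul]

theorem mainTheorem3 :
    (∀ k : ℕ, 3 ≤ k →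
      Fintype.card (DCVertex k) = 2 * k + 1 ∧
      ∃ R : RadialSystem (DCVertex k),
        IsDoubleCirclePlusVertex R ∧
        ¬ R.RealizableAsAbstractOrderType ∧
        ∀ S : Set (DCVertex k), S ≠ Set.univ → (R.induce S).RealizableAsPointSet) ∧
    ¬ ∃ m : ℕ, ∀ (V : Type) [Finite V] (R : RadialSystem V),
        (∀ S : Set V, S.ncard ≤ m → (R.induce S).RealizableAsAbstractOrderType) →
          R.RealizableAsAbstractOrderType := by
  refine ⟨fun k hk => ⟨card_DCVertex k, doubleCircleSystem hk,
    ⟨eventually_isRealizedByPoints_doubleCircle hk, directlyBetween_v hk, directlyBetween_w hk⟩,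
    doubleCircleSystem_not_realizable hk, fun S hS => doubleCircleSystem_induce_realizable hk hS⟩, ?_⟩
  rintro ⟨m, hm⟩
  -- With `k = m + 3` there are `2 * m + 7` labels, more than `m`, so every tested subset is proper.
  have hk : 3 ≤ m + 3 := by omega
  refine doubleCircleSystem_not_realizable hk (hm (DCVertex (m + 3)) _ fun S hS => ?_)
  refine (doubleCircleSystem_induce_realizable hk ?_).realizableAsAbstractOrderType
  rintro rfl
  rw [Set.ncard_univ, Nat.card_eq_fintype_card, card_DCVertex] at hS
  omega
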